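/- Let $S$ be a finite set and $\alpha>1$. Let $r:S\times S\to[0,\infty)$ be the jump rates of an irreducible continuous-time random walk on $S$, reversible with respect to a probability measure $m$ on $S$: $m(x)r(x,y)=m(y)r(y,x)$ for all $x,y\in S$. For $x\ne y$ in $S$ let $$\mathrm{Cap}_S(x,y)=\inf\Big\{\tfrac12\sum_{z,w\in S}m(z)r(z,w)\{f(w)-f(z)\}^2\ :\ f:S\to\mathbb R,\ f(x)=1,\ f(y)=0\Big\}.$$ Put $M_\star=\max_{x} m(x)$, $S_\star=\{x\in S: m(x)=M_\star\}$, $\kappa_\star=|S_\star|$ and $m_\star(x)=m(x)/M_\star$. Let $a(0)=1$, $a(n)=n^\alpha$ for $n\ge1$, and $g(0)=0$, $g(n)=a(n)/a(n-1)$ for $n\ge 1$. For $N\ge1$ let $E_N=\{\eta\in\{0,1,2,\dots\}^S:\sum_{x}\eta_x=N\}$, and for $x\neq y$ and $\eta_x>0$ let $\sigma^{xy}\eta$ be $\eta$ with one particle moved from $x$ to $y$. The zero range process on $E_N$ jumps from $\eta$ to $\sigma^{xy}\eta$ at rate $g(\eta_x)r(x,y)$, for $x\ne y$. It is reversible with respect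 to the probability measure $$\mu_N(\eta)=\frac{N^\alpha}{Z_{N,S}}\prod_{x\in S}\frac{m_\star(x)^{\eta_x}}{a(\eta_x)},\qquad Z_{N,S}=N^\alpha\sum_{\zeta\in E_N}\prod_{x\in S}\frac{m_\star(x)^{\zeta_x}}{a(\zeta_x)},$$ and its Dirichlet form is $$D_N(F)=\frac12\sum_{x\ne y}\sum_{\eta\in E_N}\mu_N(\eta)\,g(\eta_x)\,r(x,y)\,\{F(\sigma^{xy}\eta)-F(\eta)\}^2 ,\qquad F:E_N\to\mathbb R.$$ For disjoint $A,B\subset E_N$ let $\mathrm{Cap}_N(A,B)=\inf\{D_N(F): F=1\text{ on }A,\ F=0\text{ on }B\}$. Let $(\ell_N)$ and, for each $z\in S\setminus S_\star$, $(b_N(z))$ be real sequences with $\ell_N\to\infty$, $\ell_N/N\to0$ and $b_N(z)\to\infty$. For $x\in S_\star$ let $$\mathcal E_N^x=\{\eta\in E_N:\ \eta_x\ge N-\ell_N,\ \eta_z\le b_N(z)\text{ for all }z\in S\setminus S_\star\},$$ and $\mathcal E_N(T)=\bigcup_{x\in T}\mathcal E^x_N$ for $T\subset S_\star$; for all large $N$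 the sets $\mathcal E_N^x$, $x\in S_\star$, are pairwise disjoint. **Theorem.** Assume $\kappa_\star\ge2$, let $S_\star^1$ be a nonempty proper subset of $S_\star$ and $S_\star^2=S_\star\setminus S_\star^1$. Then $$\lim_{N\to\infty}N^{1+\alpha}\,\mathrm{Cap}_N\big(\mathcal E_N(S_\star^1),\mathcal E_N(S_\star^2)\big)=\frac1{M_\star\,\kappa_\star\,\Gamma(\alpha)\,I_\alpha}\sum_{x\in S_\star^1,\ y\in S_\star^2}\mathrm{Cap}_S(x,y),$$ where $\Gamma(\alpha)=\sum_{j\ge0}1/a(j)$ (not Euler's Gamma function) and $I_\alpha=\int_0^1u^\alpha(1-u)^\alpha\,du$. -/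

import Mathlib

open Filter Topology

noncomputable section

namespace ZeroRange

/-! ### The underlying random walk on the finite set `S` -/

/-- The walk with jump rates `r` is irreducible: every site can be reached from every other site
through jumps of positive rate. -/
def Irreducible {S : Type*} (r : S → S → ℝ) : Prop :=
  ∀ x y : S, Relation.ReflTransGen (fun u v => 0 < r u v) x y

/-- `D_S(f) = (1/2) ∑_{x,y} m(x) r(x,y) (f(y) - f(x))²`. -/
def walkDirichlet {S : Type*} [Fintype S] (r : S → S → ℝ) (m : S → ℝ) (f : S → ℝ) : ℝ :=
  1 / 2 * ∑ x, ∑ y, m x * r x y * (f y - f x) ^ 2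

/-- `Cap_S(x,y)`, the infimum of `D_S(f)` over all `f` with `f(x) = 1` and `f(y) = 0`. -/
def walkCap {S : Type*} [Fintype S] (r : S → S → ℝ) (m : S → ℝ) (x y : S) : ℝ :=
  sInf (walkDirichlet r m '' {f : S → ℝ | f x = 1 ∧ f y = 0})

/-- `M⋆ = max_x m(x)` (a supremum over a finite set). -/
def maxMass {S : Type*} (m : S → ℝ) : ℝ := ⨆ x, m x

/-- `S⋆ = {x : m(x) = M⋆}`. -/
def maxSites {S : Type*} [Fintype S] (m : S → ℝ) : Finset S :=
  {x | m x = maxMass m}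

/-- `m⋆(x) = m(x) / M⋆`. -/
def mStar {S : Type*} (m : S → ℝ) (x : S) : ℝ := m x / maxMass m

/-! ### The zero range process with `N` particles -/

/-- `a(0) = 1` and `a(n) = n ^ α` for `n ≥ 1`. -/
def aFun (α : ℝ) (n : ℕ) : ℝ := if n = 0 then 1 else (n : ℝ) ^ α

/-- `g(0) = 0` and `g(n) = a(n) / a(n-1)` for `n ≥ 1`; in particular `g(1) = 1`. -/
def gFun (α : ℝ) (n : ℕ) : ℝ := if n = 0 then 0 else aFun α n / aFun α (n - 1)

/-- `E_N`, the configurations `η : S → ℕ` with `∑ x, η x = N`. -/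
def configs (S : Type*) [Fintype S] [DecidableEq S] (N : ℕ) : Finset (S → ℕ) :=
  Finset.piAntidiag Finset.univ N

/-- `σ^{xy} η`: one particle is moved from `x` to `y`. It is only used with `x ≠ y`, and with a
vanishing coefficient when `η x = 0`. -/
def move {S : Type*} [DecidableEq S] (x y : S) (η : S → ℕ) : S → ℕ :=
  fun z => if z = x then η x - 1 else if z = y then η y + 1 else η z

/-- The unnormalized weight `∏ x, m⋆(x) ^ η_x / a(η_x)`. -/
def weight {S : Type*} [Fintype S] (α : ℝ) (m : S → ℝ) (η : S → ℕ) : ℝ :=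
  ∏ x, mStar m x ^ η x / aFun α (η x)

/-- The normalizing constant `Z_{N,S}`. -/
def partitionZ {S : Type*} [Fintype S] [DecidableEq S] (α : ℝ) (m : S → ℝ) (N : ℕ) : ℝ :=
  (N : ℝ) ^ α * ∑ η ∈ configs S N, weight α m η

/-- The invariant probability measure `μ_N` on `E_N`. -/
def invMeasure {S : Type*} [Fintype S] [DecidableEq S] (α : ℝ) (m : S → ℝ) (N : ℕ)
    (η : S → ℕ) : ℝ :=
  (N : ℝ) ^ α / partitionZ α m N * weight α m η

/-- The Dirichlet form `D_N` of the zero range process in which a particle jumps from `x` to `y` at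
rate `g(η_x) r(x,y)`. Functions on `E_N` are represented by functions `F` of all configurations;
only the values of `F` on `E_N` enter. -/
def zrDirichlet {S : Type*} [Fintype S] [DecidableEq S] (α : ℝ) (r : S → S → ℝ) (m : S → ℝ)
    (N : ℕ) (F : (S → ℕ) → ℝ) : ℝ :=
  1 / 2 * ∑ x, ∑ y ∈ Finset.univ.erase x, ∑ η ∈ configs S N,
    invMeasure α m N η * gFun α (η x) * r x y * (F (move x y η) - F η) ^ 2

/-- `Cap_N(A,B)` for disjoint `A, B ⊆ E_N`: the infimum of `D_N(F)` over all `F` equal to `1`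
on `A` and to `0` on `B`. -/
def zrCap {S : Type*} [Fintype S] [DecidableEq S] (α : ℝ) (r : S → S → ℝ) (m : S → ℝ)
    (N : ℕ) (A B : Set (S → ℕ)) : ℝ :=
  sInf (zrDirichlet α r m N '' {F | (∀ η ∈ A, F η = 1) ∧ (∀ ξ ∈ B, F ξ = 0)})

/-- The well `ℰ_N^x`: configurations of `E_N` with `η_x ≥ N - ℓ_N` and `η_z ≤ b_N(z)` for all
`z ∉ S⋆`. -/
def well {S : Type*} [Fintype S] [DecidableEq S] (m : S → ℝ) (ℓ : ℕ → ℝ) (b : ℕ → S → ℝ)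
    (N : ℕ) (x : S) : Set (S → ℕ) :=
  {η | η ∈ configs S N ∧ (N : ℝ) - ℓ N ≤ (η x : ℝ) ∧ ∀ z, z ∉ maxSites m → (η z : ℝ) ≤ b N z}

/-- `ℰ_N(T) = ⋃_{x ∈ T} ℰ_N^x`. -/
def wells {S : Type*} [Fintype S] [DecidableEq S] (m : S → ℝ) (ℓ : ℕ → ℝ) (b : ℕ → S → ℝ)
    (N : ℕ) (T : Finset S) : Set (S → ℕ) :=
  ⋃ x ∈ T, well m ℓ b N x

/-- `Γ(α) = ∑_{j ≥ 0} 1 / a(j)`, a convergent series for `α > 1`. -/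
def GammaConst (α : ℝ) : ℝ := ∑' j : ℕ, 1 / aFun α j

/-- `I_α = ∫₀¹ u^α (1-u)^α du`. -/
def IConst (α : ℝ) : ℝ := ∫ u in (0 : ℝ)..1, u ^ α * (1 - u) ^ α

end ZeroRange

end

set_option linter.unusedSectionVars false

noncomputable section

namespace ZeroRange

/-! ### Comparison of finite sums -/

/-! Write `η = ξ + e_x` with `ξ` a configuration of `N - 1` particles. Since `g(n) = a(n)/a(n-1)`,
the product `μ_N(η) g(η_x)` is `weight(ξ) m(x)` times a constant. Hence `D_N(F)` equals `N^α / (Z_N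
M⋆)` times the sum over `ξ` of `weight(ξ)` times the walk's Dirichlet form of `z ↦ F(ξ + e_z)`
(`zrDirichlet_eq`). The constants `Z_N` converge, because the mass sits on configurations with all
but a bounded number of particles at one site of `S⋆` (`tendsto_partitionZ`). It remains to compare
sums over `ξ`, mostly by injective reindexing.

Lower bound. Fix `x ∈ S₁`, `y ∈ S⋆ \ S₁` and a background `ζ` on the other sites, and let `i`
particles sit at `x` and `j` at `y`. Each such `ξ` contributes at least `Cap_S(x,y) weight(ζ) /
(a(i)a(j))` times the squared increment of `F` from `ξ + e_y` to `ξ + e_x`. These are conductances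
in series, so by Cauchy-Schwarz the segment contributes at least `Cap_S(x,y) weight(ζ) / ∑
a(i)a(j)`, and the last sum is at most about `N^(2α+1) I_α`. Segments for different pairs and
backgrounds are disjoint, so the contributions add up (`partCapSum_le`).

Upper bound. In the tube of configurations carried mostly by `x` and `y`, take `F(η) = φ(∑ h(z) η_z
/ N)`, with `h` nearly optimal for `Cap_S(x,y)` and `φ'` proportional to `u^α (1-u)^α`, up to a
small shrinking of the interval. This makes the series bound almost an equality. The tube functions
are compatible, with Lipschitz constant `O(1/N)`, and are glued by a Lipschitz extension
(`Interpolation.exists_testFun`). Outside the tubes a configuration costs `O(N^(-2))` times its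
weight. What remains there is the case of two large sites with a background exceeding `K`, whose
total vanishes as `K → ∞`, and that of many particles off `S⋆`, which is exponentially unlikely.

Backgrounds are truncated at `K` particles per site; `N → ∞` comes first, then `K → ∞`. Every site
`z` that is not an endpoint yields a factor `∑_j m⋆(z)^j / a(j)`, equal to `Γ(α)` on `S⋆`. The
quotient of these products by the limit of `Z_N` gives the constant (`limit_eq`). -/

theorem sum_le_sum_of_injOn {β γ : Type*} [DecidableEq γ] {s : Finset β} {t : Finset γ}
    {f : β → ℝ} {g : γ → ℝ} (e : β → γ) (hinj : Set.InjOn e s) (hmem : ∀ a ∈ s, e a ∈ t)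
    (hfg : ∀ a ∈ s, f a ≤ g (e a)) (hg : ∀ b ∈ t, 0 ≤ g b) :
    ∑ a ∈ s, f a ≤ ∑ b ∈ t, g b := by
  calc ∑ a ∈ s, f a ≤ ∑ a ∈ s, g (e a) := Finset.sum_le_sum hfg
    _ = ∑ b ∈ s.image e, g b := (Finset.sum_image hinj).symm
    _ ≤ ∑ b ∈ t, g b := by
      refine Finset.sum_le_sum_of_subset_of_nonneg ?_ (fun b hb _ => hg b hb)
      exact Finset.image_subset_iff.2 hmem

theorem sum_union_le {β : Type*} [DecidableEq β] {f : β → ℝ} (hf : ∀ b, 0 ≤ f b)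
    (s t : Finset β) : ∑ b ∈ s ∪ t, f b ≤ ∑ b ∈ s, f b + ∑ b ∈ t, f b := by
  rw [← Finset.sum_union_inter]
  exact le_add_of_nonneg_right (Finset.sum_nonneg fun b _ => hf b)

theorem sum_biUnion_le {ι β : Type*} [DecidableEq β] {f : β → ℝ} (hf : ∀ b, 0 ≤ f b)
    (s : Finset ι) (t : ι → Finset β) :
    ∑ b ∈ s.biUnion t, f b ≤ ∑ i ∈ s, ∑ b ∈ t i, f b := by
  classical
  induction s using Finset.induction_on with
  | empty => simp
  | insert a s ha ih =>
    rw [Finset.biUnion_insert, Finset.sum_insert ha]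
    exact (sum_union_le hf _ _).trans (add_le_add le_rfl ih)

/-! ### The function `a` -/

section aFun

variable {α : ℝ}

@[simp] theorem aFun_zero : aFun α 0 = 1 := by simp [aFun]

theorem aFun_of_pos {n : ℕ} (hn : 0 < n) : aFun α n = (n : ℝ) ^ α := by
  simp [aFun, hn.ne']

theorem one_le_aFun (hα : 0 ≤ α) (n : ℕ) : 1 ≤ aFun α n := by
  rcases Nat.eq_zero_or_pos n with rfl | hn
  · simp
  · rw [aFun_of_pos hn]
    exact Real.one_le_rpow (by exact_mod_cast hn) hα

theorem aFun_pos (n : ℕ) : 0 < aFun α n := by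
  rcases Nat.eq_zero_or_pos n with rfl | hn
  · simp
  · rw [aFun_of_pos hn]
    exact Real.rpow_pos_of_pos (by exact_mod_cast hn) α

theorem aFun_mono (hα : 0 ≤ α) {n k : ℕ} (h : n ≤ k) : aFun α n ≤ aFun α k := by
  rcases Nat.eq_zero_or_pos n with rfl | hn
  · simpa using one_le_aFun hα k
  · rw [aFun_of_pos hn, aFun_of_pos (hn.trans_le h)]
    exact Real.rpow_le_rpow (by positivity) (by exact_mod_cast h) hα

theorem rpow_le_aFun (hα : 0 < α) (n : ℕ) : (n : ℝ) ^ α ≤ aFun α n := by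
  rcases Nat.eq_zero_or_pos n with rfl | hn
  · simp [Real.zero_rpow hα.ne']
  · rw [aFun_of_pos hn]

theorem summable_one_div_aFun (hα : 1 < α) : Summable fun j => 1 / aFun α j := by
  refine Summable.of_nonneg_of_le (fun j => by have := aFun_pos (α := α) j; positivity) ?_
    ((Real.summable_one_div_nat_rpow.2 hα).add
      (summable_of_ne_finset_zero (s := {0}) (f := fun j : ℕ => if j = 0 then (1 : ℝ) else 0)
        (by intro b hb; simpa using hb)))
  intro j
  rcases Nat.eq_zero_or_pos j with rfl | hj
  · have : (0 : ℝ) ≤ 1 / (0 : ℝ) ^ α := by positivity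
    simpa using this
  · simp [aFun_of_pos hj, hj.ne']

theorem GammaConst_pos (hα : 1 < α) : 0 < GammaConst α := by
  refine (summable_one_div_aFun hα).tsum_pos (fun j => ?_) 0 (by simp)
  have := aFun_pos (α := α) j
  positivity

end aFun

/-! ### The site weights -/

section sites

variable {S : Type*} {α : ℝ} {m : S → ℝ}

theorem le_maxMass [Fintype S] (x : S) : m x ≤ maxMass m :=
  le_ciSup (Set.finite_range m).bddAbove x

theorem mem_maxSites [Fintype S] {x : S} : x ∈ maxSites m ↔ m x = maxMass m := by
  simp [maxSites]

theorem mStar_nonneg [Fintype S] (hm : ∀ x, 0 ≤ m x) (x : S) : 0 ≤ mStar m x :=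
  div_nonneg (hm x) ((hm x).trans (le_maxMass x))

theorem mStar_le_one [Fintype S] (hm : ∀ x, 0 ≤ m x) (x : S) : mStar m x ≤ 1 :=
  div_le_one_of_le₀ (le_maxMass x) ((hm x).trans (le_maxMass x))

theorem mStar_eq_one [Fintype S] (hM : 0 < maxMass m) {x : S} (hx : x ∈ maxSites m) :
    mStar m x = 1 := by
  rw [mStar, mem_maxSites.1 hx, div_self hM.ne']

theorem mStar_lt_one [Fintype S] (hM : 0 < maxMass m) {x : S} (hx : x ∉ maxSites m) :
    mStar m x < 1 := by
  rw [mStar, div_lt_one hM]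
  exact lt_of_le_of_ne (le_maxMass x) (fun h => hx (mem_maxSites.2 h))

/-- The number `∑_j m⋆(z)^j / a(j)`. -/
def siteGamma (α : ℝ) (m : S → ℝ) (z : S) : ℝ := ∑' j : ℕ, mStar m z ^ j / aFun α j

/-- The partial sum `∑_{j ≤ K} m⋆(z)^j / a(j)`. -/
def partGamma (α : ℝ) (m : S → ℝ) (K : ℕ) (z : S) : ℝ :=
  ∑ j ∈ Finset.range (K + 1), mStar m z ^ j / aFun α j

variable [Fintype S]

theorem siteTerm_nonneg (hm : ∀ x, 0 ≤ m x) (z : S) (j : ℕ) :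
    0 ≤ mStar m z ^ j / aFun α j :=
  div_nonneg (pow_nonneg (mStar_nonneg hm z) j) (aFun_pos j).le

theorem summable_siteTerm (hα : 1 < α) (hm : ∀ x, 0 ≤ m x) (z : S) :
    Summable fun j : ℕ => mStar m z ^ j / aFun α j := by
  refine Summable.of_nonneg_of_le (siteTerm_nonneg hm z) (fun j => ?_) (summable_one_div_aFun hα)
  have := aFun_pos (α := α) j
  gcongr
  exact pow_le_one₀ (mStar_nonneg hm z) (mStar_le_one hm z)

theorem tendsto_partGamma (hα : 1 < α) (hm : ∀ x, 0 ≤ m x) (z : S) :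
    Tendsto (fun K => partGamma α m K z) atTop (𝓝 (siteGamma α m z)) :=
  (summable_siteTerm hα hm z).hasSum.tendsto_sum_nat.comp (tendsto_add_atTop_nat 1)

theorem partGamma_le (hα : 1 < α) (hm : ∀ x, 0 ≤ m x) (K : ℕ) (z : S) :
    partGamma α m K z ≤ siteGamma α m z :=
  (summable_siteTerm hα hm z).sum_le_tsum _ (fun j _ => siteTerm_nonneg hm z j)

theorem one_le_partGamma (hm : ∀ x, 0 ≤ m x) (K : ℕ) (z : S) : 1 ≤ partGamma α m K z := by
  have := Finset.single_le_sum (f := fun j => mStar m z ^ j / aFun α j)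
    (fun j _ => siteTerm_nonneg hm z j) (Finset.mem_range.2 K.succ_pos)
  simpa [partGamma] using this

theorem siteGamma_pos (hα : 1 < α) (hm : ∀ x, 0 ≤ m x) (z : S) : 0 < siteGamma α m z :=
  zero_lt_one.trans_le ((one_le_partGamma hm 0 z).trans (partGamma_le hα hm 0 z))

theorem siteGamma_of_mem (hM : 0 < maxMass m) {x : S} (hx : x ∈ maxSites m) :
    siteGamma α m x = GammaConst α := by
  simp [siteGamma, GammaConst, mStar_eq_one hM hx]

theorem tendsto_prod_partGamma (hα : 1 < α) (hm : ∀ x, 0 ≤ m x) (A : Finset S) :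
    Tendsto (fun K => ∏ z ∈ A, partGamma α m K z) atTop (𝓝 (∏ z ∈ A, siteGamma α m z)) :=
  tendsto_finsetProd _ fun z _ => tendsto_partGamma hα hm z

theorem prod_partGamma_le (hα : 1 < α) (hm : ∀ x, 0 ≤ m x) (K : ℕ) (A : Finset S) :
    ∏ z ∈ A, partGamma α m K z ≤ ∏ z ∈ A, siteGamma α m z :=
  Finset.prod_le_prod (fun z _ => zero_le_one.trans (one_le_partGamma hm K z))
    fun z _ => partGamma_le hα hm K z

end sites

/-! ### Configurations -/

section configs

variable {S : Type*} [Fintype S] [DecidableEq S] {α : ℝ} {m : S → ℝ}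

theorem mem_configs {N : ℕ} {η : S → ℕ} : η ∈ configs S N ↔ ∑ x, η x = N := by
  simp [configs, Finset.mem_piAntidiag]

theorem le_of_mem_configs {N : ℕ} {η : S → ℕ} (h : η ∈ configs S N) (x : S) : η x ≤ N := by
  rw [← mem_configs.1 h]
  exact Finset.single_le_sum (fun _ _ => Nat.zero_le _) (Finset.mem_univ x)

/-- The configuration `ξ` with a particle added at `z`. -/
def addOne (ξ : S → ℕ) (z : S) : S → ℕ := ξ + Pi.single z 1

theorem addOne_self (ξ : S → ℕ) (z : S) : addOne ξ z z = ξ z + 1 := by simp [addOne]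

theorem addOne_of_ne (ξ : S → ℕ) {z w : S} (h : w ≠ z) : addOne ξ z w = ξ w := by
  simp [addOne, h]

theorem le_addOne (ξ : S → ℕ) (z w : S) : ξ w ≤ addOne ξ z w := by simp [addOne]

theorem addOne_le (ξ : S → ℕ) (z w : S) : addOne ξ z w ≤ ξ w + 1 := by
  by_cases h : w = z
  · subst h; simp [addOne]
  · simp [addOne_of_ne ξ h]

theorem sum_addOne_mul (ξ : S → ℕ) (z : S) (h : S → ℝ) :
    ∑ w, h w * (addOne ξ z w : ℝ) = ∑ w, h w * (ξ w : ℝ) + h z := by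
  simp only [addOne, Pi.add_apply, Nat.cast_add, mul_add, Finset.sum_add_distrib]
  congr 1
  simp [Pi.single_apply]

theorem addOne_mem {n : ℕ} {ξ : S → ℕ} (h : ξ ∈ configs S n) (z : S) :
    addOne ξ z ∈ configs S (n + 1) := by
  rw [mem_configs] at *
  simp [addOne, Finset.sum_add_distrib, h]

/-- Configurations carry the sup distance. A single jump therefore has length at most one, and
Lipschitz constants bound increments along jumps directly. -/
theorem dist_addOne_le (ξ : S → ℕ) (z w : S) : dist (addOne ξ z) (addOne ξ w) ≤ 1 := by
  refine (dist_pi_le_iff zero_le_one).2 fun v => ?_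
  have h1 := le_addOne ξ z v
  have h2 := addOne_le ξ z v
  have h3 := le_addOne ξ w v
  have h4 := addOne_le ξ w v
  rw [Nat.dist_eq, abs_le]
  constructor
  · have : (addOne ξ w v : ℝ) ≤ addOne ξ z v + 1 := by exact_mod_cast h4.trans (by omega)
    linarith
  · have : (addOne ξ z v : ℝ) ≤ addOne ξ w v + 1 := by exact_mod_cast h2.trans (by omega)
    linarith

/-- The configuration `ξ` with the sites of `A` emptied. -/
def clearOn (A : Finset S) (ξ : S → ℕ) : S → ℕ := fun z => if z ∈ A then 0 else ξ z

/-- The configurations which vanish on `A` and have at most `K` particles at every other site. -/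
def box (A : Finset S) (K : ℕ) : Finset (S → ℕ) :=
  Fintype.piFinset fun z => if z ∈ A then {0} else Finset.range (K + 1)

theorem mem_box {A : Finset S} {K : ℕ} {ζ : S → ℕ} :
    ζ ∈ box A K ↔ (∀ z ∈ A, ζ z = 0) ∧ ∀ z ∉ A, ζ z ≤ K := by
  simp only [box, Fintype.mem_piFinset]
  constructor
  · intro h
    refine ⟨fun z hz => by simpa [hz] using h z, fun z hz => ?_⟩
    have := h z
    simp only [hz, if_false, Finset.mem_range] at this
    omega
  · rintro ⟨h1, h2⟩ z
    by_cases hz : z ∈ A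
    · simp [hz, h1 z hz]
    · simp only [hz, if_false, Finset.mem_range]
      have := h2 z hz
      omega

theorem clearOn_mem_box {A : Finset S} {K : ℕ} {ξ : S → ℕ} :
    clearOn A ξ ∈ box A K ↔ ∀ z ∉ A, ξ z ≤ K := by
  rw [mem_box]
  constructor
  · rintro ⟨-, h⟩ z hz
    simpa [clearOn, hz] using h z hz
  · intro h
    exact ⟨fun z hz => by simp [clearOn, hz], fun z hz => by simpa [clearOn, hz] using h z hz⟩

theorem clearOn_mem_box_of_configs {A : Finset S} {n : ℕ} {ξ : S → ℕ} (h : ξ ∈ configs S n) :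
    clearOn A ξ ∈ box A n :=
  clearOn_mem_box.2 fun z _ => le_of_mem_configs h z

theorem sum_le_of_mem_box {A : Finset S} {K : ℕ} {ζ : S → ℕ} (h : ζ ∈ box A K) :
    ∑ z, ζ z ≤ Fintype.card S * K := by
  have : ∀ z ∈ Finset.univ, ζ z ≤ K := fun z _ => by
    by_cases hz : z ∈ A
    · simp [(mem_box.1 h).1 z hz]
    · exact (mem_box.1 h).2 z hz
  simpa using Finset.sum_le_card_nsmul _ _ _ this

theorem box_mono {A : Finset S} {K n : ℕ} (h : K ≤ n) : box A K ⊆ box A n := by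
  intro ζ hζ
  rw [mem_box] at *
  exact ⟨hζ.1, fun z hz => (hζ.2 z hz).trans h⟩

theorem sum_clearOn (A : Finset S) (ξ : S → ℕ) :
    ∑ z, ξ z = ∑ z, clearOn A ξ z + ∑ z ∈ A, ξ z := by
  have : ∑ z, clearOn A ξ z = ∑ z ∈ Finset.univ \ A, ξ z := by
    rw [Finset.sdiff_eq_filter, Finset.sum_filter]
    refine Finset.sum_congr rfl fun z _ => ?_
    by_cases h : z ∈ A <;> simp [clearOn, h]
  rw [this, Finset.sum_sdiff (Finset.subset_univ A)]

theorem weight_eq_clearOn (A : Finset S) (ξ : S → ℕ) :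
    weight α m ξ = weight α m (clearOn A ξ) * ∏ z ∈ A, mStar m z ^ ξ z / aFun α (ξ z) := by
  have : weight α m (clearOn A ξ) = ∏ z ∈ Finset.univ \ A, mStar m z ^ ξ z / aFun α (ξ z) := by
    rw [weight, Finset.sdiff_eq_filter, Finset.prod_filter]
    refine Finset.prod_congr rfl fun z _ => ?_
    by_cases h : z ∈ A <;> simp [clearOn, h]
  rw [this, Finset.prod_sdiff (Finset.subset_univ A), weight]

theorem weight_nonneg (hm : ∀ x, 0 ≤ m x) (ξ : S → ℕ) : 0 ≤ weight α m ξ :=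
  Finset.prod_nonneg fun z _ => siteTerm_nonneg hm z (ξ z)

theorem siteTerm_le_one (hα : 0 ≤ α) (hm : ∀ x, 0 ≤ m x) (z : S) (j : ℕ) :
    mStar m z ^ j / aFun α j ≤ 1 :=
  div_le_one_of_le₀ ((pow_le_one₀ (mStar_nonneg hm z) (mStar_le_one hm z)).trans
    (one_le_aFun hα j)) (aFun_pos j).le

theorem weight_le_siteTerm (hα : 0 ≤ α) (hm : ∀ x, 0 ≤ m x) (ξ : S → ℕ) (z : S) :
    weight α m ξ ≤ mStar m z ^ ξ z / aFun α (ξ z) := by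
  rw [weight, ← Finset.mul_prod_erase _ _ (Finset.mem_univ z)]
  refine mul_le_of_le_one_right (siteTerm_nonneg hm z _) ?_
  exact Finset.prod_le_one (fun w _ => siteTerm_nonneg hm w _) fun w _ => siteTerm_le_one hα hm w _

theorem sum_box_weight (A : Finset S) (K : ℕ) :
    ∑ ζ ∈ box A K, weight α m ζ = ∏ z ∈ Finset.univ \ A, partGamma α m K z := by
  simp only [box, weight]
  rw [← Finset.prod_univ_sum (fun z => if z ∈ A then {0} else Finset.range (K + 1))
    (fun z j => mStar m z ^ j / aFun α j), Finset.sdiff_eq_filter, Finset.prod_filter]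
  refine Finset.prod_congr rfl fun z _ => ?_
  by_cases h : z ∈ A <;> simp [partGamma, h]

/-- The total weight of the configurations vanishing on `A` with more than `K` particles at some
site. -/
def boxTail (α : ℝ) (m : S → ℝ) (A : Finset S) (K : ℕ) : ℝ :=
  ∏ z ∈ Finset.univ \ A, siteGamma α m z - ∏ z ∈ Finset.univ \ A, partGamma α m K z

theorem tendsto_boxTail (hα : 1 < α) (hm : ∀ x, 0 ≤ m x) (A : Finset S) :
    Tendsto (boxTail α m A) atTop (𝓝 0) := by
  have := (tendsto_prod_partGamma hα hm (Finset.univ \ A)).const_sub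
    (∏ z ∈ Finset.univ \ A, siteGamma α m z)
  rw [sub_self] at this
  exact this

theorem sum_box_sdiff_le (hα : 1 < α) (hm : ∀ x, 0 ≤ m x) (A : Finset S) {K n : ℕ} (h : K ≤ n) :
    ∑ ζ ∈ box A n \ box A K, weight α m ζ ≤ boxTail α m A K := by
  have h1 := Finset.sum_sdiff (box_mono (A := A) h) (f := weight α m)
  rw [sum_box_weight, sum_box_weight] at h1
  have := prod_partGamma_le hα hm n (Finset.univ \ A)
  rw [boxTail]
  linarith

/-! ### Configurations with many particles outside `S⋆` -/

theorem card_configs_le (n : ℕ) : (configs S n).card ≤ (n + 1) ^ Fintype.card S := by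
  have : configs S n ⊆ Fintype.piFinset fun _ : S => Finset.range (n + 1) := by
    intro ξ hξ
    rw [Fintype.mem_piFinset]
    intro z
    have := le_of_mem_configs hξ z
    simp only [Finset.mem_range]
    omega
  simpa using Finset.card_le_card this

open Classical in
-- One site off `S⋆` with `δN` particles already costs `θ^(δN)` for a uniform `θ < 1`, while there
-- are only polynomially many configurations, at most `(n+1)^|S| ≤ (2N)^|S|`.
theorem exists_sum_outside_le (hα : 0 ≤ α) (hm : ∀ x, 0 ≤ m x) (hM : 0 < maxMass m) {δ : ℝ}
    (hδ : 0 < δ) : ∃ q : ℝ, 0 < q ∧ ∀ N n : ℕ, 1 ≤ N → n ≤ N →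
      ∑ ξ ∈ configs S n with ∃ z ∉ maxSites m, δ * N ≤ ξ z, weight α m ξ
        ≤ 2 ^ Fintype.card S * (N : ℝ) ^ (Fintype.card S : ℝ) * Real.exp (-q * N) := by
  -- `θ` is the largest `m⋆` off `S⋆` (`0` if there is no such site), raised to at least `1/2` so
  -- that `log θ` is meaningful.
  obtain ⟨θ, hθ0, hθ1, hθ⟩ : ∃ θ : ℝ, 0 < θ ∧ θ < 1 ∧ ∀ z ∉ maxSites m, mStar m z ≤ θ := by
    have h1 : ∃ θ < 1, ∀ z ∈ (Finset.univ.filter fun z => z ∉ maxSites m), mStar m z ≤ θ := by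
      rcases (Finset.univ.filter fun z => z ∉ maxSites m).eq_empty_or_nonempty with he | hne
      · exact ⟨0, by norm_num, by simp [he]⟩
      · refine ⟨Finset.sup' _ hne (mStar m), ?_, fun z hz => Finset.le_sup' (mStar m) hz⟩
        rw [Finset.sup'_lt_iff hne]
        intro z hz
        exact mStar_lt_one hM (Finset.mem_filter.1 hz).2
    obtain ⟨θ, h, h'⟩ := h1
    refine ⟨max θ (1 / 2), by positivity, max_lt h (by norm_num), fun z hz => ?_⟩
    exact (h' z (by simpa using hz)).trans (le_max_left _ _)
  refine ⟨-Real.log θ * δ, mul_pos (neg_pos.2 (Real.log_neg hθ0 hθ1)) hδ, fun N n hN hn => ?_⟩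
  have hb : ∀ ξ ∈ (configs S n).filter (fun ξ => ∃ z ∉ maxSites m, δ * N ≤ ξ z),
      weight α m ξ ≤ Real.exp (-(-Real.log θ * δ) * N) := by
    intro ξ hξ
    obtain ⟨-, z, hz, hz'⟩ := Finset.mem_filter.1 hξ
    refine (weight_le_siteTerm hα hm ξ z).trans ?_
    refine (div_le_self (pow_nonneg (mStar_nonneg hm z) _) (one_le_aFun hα _)).trans ?_
    refine (pow_le_pow_left₀ (mStar_nonneg hm z) (hθ z hz) _).trans ?_
    rw [← Real.rpow_natCast, Real.rpow_def_of_pos hθ0]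
    refine Real.exp_le_exp.2 ?_
    have := Real.log_neg hθ0 hθ1
    nlinarith
  refine (Finset.sum_le_card_nsmul _ _ _ hb).trans ?_
  rw [nsmul_eq_mul]
  gcongr
  have h1 : (((configs S n).filter (fun ξ => ∃ z ∉ maxSites m, δ * N ≤ ξ z)).card : ℝ)
      ≤ ((n + 1) ^ Fintype.card S : ℕ) := by
    exact_mod_cast (Finset.card_filter_le _ _).trans (card_configs_le n)
  refine h1.trans ?_
  rw [Real.rpow_natCast, ← mul_pow]
  push_cast
  have h2 : (n : ℝ) ≤ N := by exact_mod_cast hn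
  have h3 : (1 : ℝ) ≤ N := by exact_mod_cast hN
  gcongr
  linarith

end configs

/-! ### Asymptotics of the normalizing constant -/

theorem tendsto_rpow_div_aFun (α : ℝ) (k : ℕ) :
    Tendsto (fun N : ℕ => (N : ℝ) ^ α / aFun α (N - k)) atTop (𝓝 1) := by
  have h1 : Tendsto (fun N : ℕ => ((N : ℝ) / ((N : ℝ) + ((-k : ℝ)))) ^ α) atTop (𝓝 1) := by
    have := (tendsto_natCast_div_add_atTop (𝕜 := ℝ) (-k : ℝ)).rpow_const (p := α)
      (Or.inl one_ne_zero)
    simpa using this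
  refine h1.congr' ?_
  filter_upwards [eventually_gt_atTop k] with N hN
  rw [aFun_of_pos (by omega), Nat.cast_sub hN.le, ← sub_eq_add_neg, Real.div_rpow (by positivity)]
  have : (k : ℝ) < N := by exact_mod_cast hN
  linarith

theorem tendsto_rpow_mul_exp_neg (c s q : ℝ) (hq : 0 < q) :
    Tendsto (fun N : ℕ => c * ((N : ℝ) ^ s * Real.exp (-q * N))) atTop (𝓝 0) := by
  have := ((tendsto_rpow_mul_exp_neg_mul_atTop_nhds_zero s q hq).comp
    (tendsto_natCast_atTop_atTop (R := ℝ))).const_mul c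
  simpa using this

/-- This performs the double limit: for each fixed truncation `K` let `N → ∞`, and only then `K →
∞`. No uniformity in `K` is needed, since one good `K` suffices for each `c`. -/
theorem le_of_eventually_le_family {f : ℕ → ℝ} {u : ℕ → ℕ → ℝ} {v : ℕ → ℝ} {L : ℝ}
    (hfu : ∀ K, ∀ᶠ N in atTop, f N ≤ u K N) (hu : ∀ K, Tendsto (u K) atTop (𝓝 (v K)))
    (hv : Tendsto v atTop (𝓝 L)) {c : ℝ} (hc : L < c) : ∀ᶠ N in atTop, f N < c := by
  obtain ⟨K, hK⟩ := (hv.eventually_lt_const hc).exists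
  filter_upwards [hfu K, (hu K).eventually_lt_const hK] with N h1 h2
  exact h1.trans_lt h2

theorem ge_of_eventually_ge_family {f : ℕ → ℝ} {u : ℕ → ℕ → ℝ} {v : ℕ → ℝ} {L : ℝ}
    (hfu : ∀ K, ∀ᶠ N in atTop, u K N ≤ f N) (hu : ∀ K, Tendsto (u K) atTop (𝓝 (v K)))
    (hv : Tendsto v atTop (𝓝 L)) {c : ℝ} (hc : c < L) : ∀ᶠ N in atTop, c < f N := by
  obtain ⟨K, hK⟩ := (hv.eventually_const_lt hc).exists
  filter_upwards [hfu K, (hu K).eventually_const_lt hK] with N h1 h2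
  exact h2.trans_le h1

section partition

variable {S : Type*} [Fintype S] [DecidableEq S] {α : ℝ} {m : S → ℝ}

theorem eq_of_clearOn_eq {A : Finset S} {ξ η : S → ℕ} (h : clearOn A ξ = clearOn A η)
    (hA : ∀ z ∈ A, ξ z = η z) : ξ = η := by
  funext z
  by_cases hz : z ∈ A
  · exact hA z hz
  · simpa [clearOn, hz] using congrFun h z

theorem weight_eq_clearOn_singleton (hM : 0 < maxMass m) {x : S} (hx : x ∈ maxSites m) {N : ℕ}
    {η : S → ℕ} (hη : η ∈ configs S N) :
    weight α m η = weight α m (clearOn {x} η) / aFun α (N - ∑ z, clearOn {x} η z) := by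
  have h1 := sum_clearOn {x} η
  rw [mem_configs.1 hη, Finset.sum_singleton] at h1
  have h2 : N - ∑ z, clearOn {x} η z = η x := by omega
  rw [h2, weight_eq_clearOn {x} η, Finset.prod_singleton, mStar_eq_one hM hx, one_pow, mul_one_div]

theorem configs_inj_of_clearOn_singleton {x : S} {N : ℕ} {η ξ : S → ℕ} (hη : η ∈ configs S N)
    (hξ : ξ ∈ configs S N) (h : clearOn {x} η = clearOn {x} ξ) : η = ξ := by
  refine eq_of_clearOn_eq h fun z hz => ?_
  rw [Finset.mem_singleton] at hz
  subst hz
  have h1 := sum_clearOn {z} η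
  have h2 := sum_clearOn {z} ξ
  rw [mem_configs.1 hη, Finset.sum_singleton] at h1
  rw [mem_configs.1 hξ, Finset.sum_singleton] at h2
  rw [h] at h1
  omega

/-- The weight of the configurations concentrated at a site of `S⋆`, up to at most `K` particles
at each of the other sites. -/
def condensedSum (α : ℝ) (m : S → ℝ) (K N : ℕ) : ℝ :=
  ∑ x ∈ maxSites m, ∑ ζ ∈ box {x} K, weight α m ζ / aFun α (N - ∑ z, ζ z)

theorem tendsto_rpow_mul_condensedSum (K : ℕ) :
    Tendsto (fun N : ℕ => (N : ℝ) ^ α * condensedSum α m K N) atTop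
      (𝓝 (∑ x ∈ maxSites m, ∏ z ∈ Finset.univ \ {x}, partGamma α m K z)) := by
  simp only [← sum_box_weight, condensedSum, Finset.mul_sum]
  refine tendsto_finsetSum _ fun x _ => tendsto_finsetSum _ fun ζ _ => ?_
  have := (tendsto_rpow_div_aFun α (∑ z, ζ z)).const_mul (weight α m ζ)
  rw [mul_one] at this
  refine this.congr fun N => ?_
  ring

/-- Filling site `x` with the particles missing from `ζ` is injective in the pair `(x, ζ)`. -/
theorem condensedSum_le (hm : ∀ x, 0 ≤ m x) (hM : 0 < maxMass m) {K N : ℕ}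
    (hN : Fintype.card S * K + K < N) :
    condensedSum α m K N ≤ ∑ η ∈ configs S N, weight α m η := by
  rw [condensedSum, Finset.sum_sigma']
  let e : (Σ _ : S, S → ℕ) → S → ℕ := fun p => p.2 + Pi.single p.1 (N - ∑ z, p.2 z)
  have he1 : ∀ p ∈ (maxSites m).sigma fun x => box {x} K, e p p.1 = N - ∑ z, p.2 z := by
    rintro ⟨x, ζ⟩ hp
    simp only [Finset.mem_sigma] at hp
    simp [e, (mem_box.1 hp.2).1 x (by simp)]
  have he2 : ∀ p ∈ (maxSites m).sigma fun x => box {x} K, clearOn {p.1} (e p) = p.2 := by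
    rintro ⟨x, ζ⟩ hp
    simp only [Finset.mem_sigma] at hp
    funext z
    by_cases hz : z = x
    · subst hz
      simp [clearOn, (mem_box.1 hp.2).1 z (by simp)]
    · simp [clearOn, e, hz]
  have he3 : ∀ p ∈ (maxSites m).sigma fun x => box {x} K, e p ∈ configs S N := by
    rintro ⟨x, ζ⟩ hp
    have h1 := sum_clearOn {x} (e ⟨x, ζ⟩)
    rw [Finset.sum_singleton, he1 _ hp, he2 _ hp] at h1
    simp only [Finset.mem_sigma] at hp
    have := sum_le_of_mem_box hp.2
    rw [mem_configs, h1]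
    simp only
    omega
  refine sum_le_sum_of_injOn e ?_ he3 ?_ (fun η _ => weight_nonneg hm η)
  · intro p hp q hq hpq
    rw [Finset.mem_coe] at hp hq
    -- The filled site is the only one with more than `K` particles, as it holds at least `N - |S| K
    -- > K`.
    have hx : p.1 = q.1 := by
      by_contra hne
      have h1 := he1 _ hp
      have h2 := he2 _ hq
      rw [hpq] at h1
      simp only [Finset.mem_sigma] at hp hq
      have h3 := (mem_box.1 hq.2).2 p.1 (by simpa using hne)
      rw [← h2] at h3
      simp only [clearOn, Finset.mem_singleton, hne, if_false] at h3
      have := sum_le_of_mem_box hp.2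
      omega
    obtain ⟨x, ζ⟩ := p
    obtain ⟨y, ζ'⟩ := q
    obtain rfl : x = y := hx
    have h1 := he2 _ hp
    rw [hpq] at h1
    have h2 := he2 _ hq
    simp only at h1 h2
    rw [← h1, h2]
  · intro p hp
    have h := weight_eq_clearOn_singleton (α := α) hM (Finset.mem_sigma.1 hp).1 (he3 p hp)
    rw [h, he2 p hp]

theorem exists_card_mul_ge [Nonempty S] {N : ℕ} {η : S → ℕ} (hη : η ∈ configs S N) :
    ∃ x, N ≤ Fintype.card S * η x := by
  obtain ⟨x, -, hx⟩ := Finset.exists_max_image Finset.univ η Finset.univ_nonempty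
  refine ⟨x, ?_⟩
  rw [← mem_configs.1 hη]
  simpa using Finset.sum_le_card_nsmul Finset.univ η (η x) (fun z hz => hx z hz)

open Classical in
-- By pigeonhole some site `x` holds at least `N/|S|` particles. If `x ∈ S⋆`, either all other sites
-- hold at most `K`, which gives the condensed sum, or the factor `1/a(η_x) ≤ (|S|/N)^α` comes with
-- the tail of the background. If `x ∉ S⋆`, the configuration falls in the last sum.
theorem sum_weight_le (hα : 1 < α) (hm : ∀ x, 0 ≤ m x) (hM : 0 < maxMass m) [Nonempty S]
    {K N : ℕ} (hK : K ≤ N) (hN : 1 ≤ N) :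
    ∑ η ∈ configs S N, weight α m η ≤ condensedSum α m K N +
      ∑ x ∈ maxSites m, (Fintype.card S : ℝ) ^ α / (N : ℝ) ^ α * boxTail α m {x} K +
      ∑ η ∈ configs S N with ∃ z ∉ maxSites m, 1 / (Fintype.card S : ℝ) * N ≤ η z,
        weight α m η := by
  have hd : 0 < (Fintype.card S : ℝ) := by exact_mod_cast Fintype.card_pos
  have hN' : 0 < (N : ℝ) := by exact_mod_cast hN
  let P1 : S → Finset (S → ℕ) := fun x => (configs S N).filter fun η => clearOn {x} η ∈ box {x} K
  let P2 : S → Finset (S → ℕ) := fun x => (configs S N).filter fun η =>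
    N ≤ Fintype.card S * η x ∧ clearOn {x} η ∉ box {x} K
  let P3 := (configs S N).filter fun η => ∃ z ∉ maxSites m, 1 / (Fintype.card S : ℝ) * N ≤ η z
  have hcover : configs S N ⊆ ((maxSites m).biUnion P1 ∪ (maxSites m).biUnion P2) ∪ P3 := by
    intro η hη
    obtain ⟨x, hx⟩ := exists_card_mul_ge hη
    by_cases hxm : x ∈ maxSites m
    · refine Finset.mem_union_left _ ?_
      by_cases hb : clearOn {x} η ∈ box {x} K
      · exact Finset.mem_union_left _ (Finset.mem_biUnion.2
          ⟨x, hxm, Finset.mem_filter.2 ⟨hη, hb⟩⟩)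
      · exact Finset.mem_union_right _ (Finset.mem_biUnion.2
          ⟨x, hxm, Finset.mem_filter.2 ⟨hη, hx, hb⟩⟩)
    · refine Finset.mem_union_right _ (Finset.mem_filter.2 ⟨hη, x, hxm, ?_⟩)
      rw [one_div, inv_mul_le_iff₀ hd]
      exact_mod_cast hx
  have hw := weight_nonneg (α := α) hm
  have hU := sum_union_le hw
  have hB := fun P : S → Finset (S → ℕ) => sum_biUnion_le hw (maxSites m) P
  refine (Finset.sum_le_sum_of_subset_of_nonneg hcover fun η _ _ => hw η).trans ?_
  refine (hU _ _).trans (add_le_add_left ((hU _ _).trans (add_le_add ((hB _).trans ?_)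
    ((hB _).trans ?_))) _)
  · refine Finset.sum_le_sum fun x hx => ?_
    refine sum_le_sum_of_injOn (clearOn {x}) ?_ (fun η hη => (Finset.mem_filter.1 hη).2) ?_ ?_
    · intro η hη ξ hξ h
      exact configs_inj_of_clearOn_singleton (Finset.mem_filter.1 hη).1 (Finset.mem_filter.1 hξ).1 h
    · intro η hη
      exact (weight_eq_clearOn_singleton hM hx (Finset.mem_filter.1 hη).1).le
    · intro ζ _
      exact div_nonneg (hw ζ) (aFun_pos _).le
  · refine Finset.sum_le_sum fun x hx => ?_
    have h1 : ∑ η ∈ P2 x, weight α m η ≤ ∑ ζ ∈ box {x} N \ box {x} K,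
        (Fintype.card S : ℝ) ^ α / (N : ℝ) ^ α * weight α m ζ := by
      refine sum_le_sum_of_injOn (clearOn {x}) ?_ (fun η hη => ?_) ?_ ?_
      · intro η hη ξ hξ h
        exact configs_inj_of_clearOn_singleton (Finset.mem_filter.1 hη).1
          (Finset.mem_filter.1 hξ).1 h
      · have := Finset.mem_filter.1 hη
        exact Finset.mem_sdiff.2 ⟨clearOn_mem_box_of_configs this.1, this.2.2⟩
      · intro η hη
        obtain ⟨-, h2, -⟩ := Finset.mem_filter.1 hη
        rw [weight_eq_clearOn {x} η, Finset.prod_singleton, mStar_eq_one hM hx, one_pow,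
          mul_comm _ (weight α m _)]
        refine mul_le_mul_of_nonneg_left ?_ (hw _)
        rw [div_le_div_iff₀ (aFun_pos _) (by positivity), one_mul]
        refine le_trans ?_ (mul_le_mul_of_nonneg_left (rpow_le_aFun (by linarith) _) (by positivity))
        rw [← Real.mul_rpow hd.le (by positivity)]
        exact Real.rpow_le_rpow hN'.le (by exact_mod_cast h2) (by linarith)
      · intro ζ _
        have := hw ζ
        positivity
    refine h1.trans ?_
    rw [← Finset.mul_sum]
    exact mul_le_mul_of_nonneg_left (sum_box_sdiff_le hα hm _ hK) (by positivity)

theorem tendsto_partitionZ (hα : 1 < α) (hm : ∀ x, 0 ≤ m x) (hM : 0 < maxMass m) [Nonempty S] :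
    Tendsto (partitionZ α m) atTop
      (𝓝 (∑ x ∈ maxSites m, ∏ z ∈ Finset.univ \ {x}, siteGamma α m z)) := by
  have hd : 0 < (Fintype.card S : ℝ) := by exact_mod_cast Fintype.card_pos
  have hv : Tendsto (fun K => ∑ x ∈ maxSites m, ∏ z ∈ Finset.univ \ {x}, partGamma α m K z) atTop
      (𝓝 (∑ x ∈ maxSites m, ∏ z ∈ Finset.univ \ {x}, siteGamma α m z)) :=
    tendsto_finsetSum _ fun x _ => tendsto_prod_partGamma hα hm _
  refine tendsto_order.2 ⟨fun c hc => ?_, fun c hc => ?_⟩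
  · refine ge_of_eventually_ge_family (fun K => ?_) (fun K => tendsto_rpow_mul_condensedSum K) hv hc
    filter_upwards [eventually_gt_atTop (Fintype.card S * K + K)] with N hN
    exact mul_le_mul_of_nonneg_left (condensedSum_le hm hM hN) (by positivity)
  · obtain ⟨q, hq, hE⟩ := exists_sum_outside_le (α := α) (by linarith) hm hM (one_div_pos.2 hd)
    refine le_of_eventually_le_family (u := fun K N => (N : ℝ) ^ α * condensedSum α m K N +
      ∑ x ∈ maxSites m, (Fintype.card S : ℝ) ^ α * boxTail α m {x} K +
      2 ^ Fintype.card S * ((N : ℝ) ^ (α + (Fintype.card S : ℝ)) * Real.exp (-q * N)))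
      (fun K => ?_) (fun K => ((tendsto_rpow_mul_condensedSum K).add_const _).add
        (tendsto_rpow_mul_exp_neg _ _ q hq)) ?_ hc
    · filter_upwards [eventually_ge_atTop K, eventually_ge_atTop 1] with N hK hN
      have hN' : 0 < (N : ℝ) := by exact_mod_cast hN
      have h1 := (sum_weight_le hα hm hM hK hN).trans (add_le_add_right (hE N N hN le_rfl) _)
      rw [partitionZ]
      refine (mul_le_mul_of_nonneg_left h1 (by positivity)).trans (le_of_eq ?_)
      rw [mul_add, mul_add, Finset.mul_sum, Real.rpow_add hN']
      congr 1
      · congr 1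
        refine Finset.sum_congr rfl fun x _ => ?_
        field_simp
      · ring
    · have h2 : Tendsto (fun K => ∑ x ∈ maxSites m, (Fintype.card S : ℝ) ^ α * boxTail α m {x} K)
          atTop (𝓝 (∑ x ∈ maxSites m, (Fintype.card S : ℝ) ^ α * 0)) :=
        tendsto_finsetSum _ fun x _ => (tendsto_boxTail hα hm {x}).const_mul _
      simpa using (hv.add h2).add_const 0

end partition

/-! ### The convolution of `a` with itself -/

/-- `∑_{i + j = n} a(i) a(j)`. -/
def convSum (α : ℝ) (n : ℕ) : ℝ := ∑ i ∈ Finset.range (n + 1), aFun α i * aFun α (n - i)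

theorem convSum_pos (α : ℝ) (n : ℕ) : 0 < convSum α n :=
  Finset.sum_pos (fun i _ => mul_pos (aFun_pos i) (aFun_pos _)) ⟨0, by simp⟩

theorem continuous_rpow_mul_one_sub_rpow {α : ℝ} (hα : 0 ≤ α) :
    Continuous fun u : ℝ => u ^ α * (1 - u) ^ α :=
  (continuous_id.rpow_const fun _ => Or.inr hα).mul
    ((continuous_const.sub continuous_id).rpow_const fun _ => Or.inr hα)

theorem IConst_pos {α : ℝ} (hα : 0 ≤ α) : 0 < IConst α := by
  refine intervalIntegral.intervalIntegral_pos_of_pos_on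
    ((continuous_rpow_mul_one_sub_rpow hα).intervalIntegrable _ _) (fun u hu => ?_) one_pos
  exact mul_pos (Real.rpow_pos_of_pos hu.1 _) (Real.rpow_pos_of_pos (sub_pos.2 hu.2) _)

/-- With mesh `1/(n+1)` rather than `1/n`, on `[i/(n+1), (i+1)/(n+1)]` both `u ≥ i/(n+1)` and `1 - u
≥ (n-i)/(n+1)` hold. The sum is thus a lower Riemann-type sum and there is no error term. -/
theorem sum_rpow_mul_rpow_le {α : ℝ} (hα : 0 ≤ α) (n : ℕ) :
    ∑ i ∈ Finset.range (n + 1), (i : ℝ) ^ α * ((n - i : ℕ) : ℝ) ^ α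
      ≤ ((n + 1 : ℕ) : ℝ) ^ (2 * α + 1) * IConst α := by
  set N : ℝ := ((n + 1 : ℕ) : ℝ) with hNdef
  have hN : 0 < N := by positivity
  have hc := continuous_rpow_mul_one_sub_rpow hα
  have hI : IConst α = ∑ i ∈ Finset.range (n + 1),
      ∫ u in ((i : ℝ) / N)..(((i + 1 : ℕ) : ℝ) / N), u ^ α * (1 - u) ^ α := by
    rw [intervalIntegral.sum_integral_adjacent_intervals (a := fun i : ℕ => (i : ℝ) / N)
      fun i _ => hc.intervalIntegrable _ _, IConst]
    congr 1
    · simp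
    · rw [← hNdef, div_self hN.ne']
  rw [hI, Finset.mul_sum]
  refine Finset.sum_le_sum fun i hi => ?_
  have hin : i ≤ n := by simpa [Nat.lt_succ_iff] using hi
  have hlen : ((i : ℝ) / N) ≤ ((i + 1 : ℕ) : ℝ) / N := by
    gcongr
    simp
  have h1 : ∫ u in ((i : ℝ) / N)..(((i + 1 : ℕ) : ℝ) / N),
      ((i : ℝ) / N) ^ α * (((n - i : ℕ) : ℝ) / N) ^ α ≤
      ∫ u in ((i : ℝ) / N)..(((i + 1 : ℕ) : ℝ) / N), u ^ α * (1 - u) ^ α := by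
    refine intervalIntegral.integral_mono_on hlen (by simp) (hc.intervalIntegrable _ _) ?_
    intro u hu
    have hu0 : 0 ≤ (i : ℝ) / N := by positivity
    have h2 : (((n - i : ℕ) : ℝ) / N) ≤ 1 - u := by
      have := hu.2
      have h3 : ((n - i : ℕ) : ℝ) / N + ((i + 1 : ℕ) : ℝ) / N = 1 := by
        rw [← add_div, ← Nat.cast_add, hNdef]
        rw [show n - i + (i + 1) = n + 1 by omega, div_self (by positivity)]
      linarith
    exact mul_le_mul (Real.rpow_le_rpow hu0 hu.1 hα) (Real.rpow_le_rpow (by positivity) h2 hα)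
      (by positivity) (Real.rpow_nonneg (hu0.trans hu.1) _)
  rw [intervalIntegral.integral_const, smul_eq_mul] at h1
  refine le_trans (le_of_eq ?_) (mul_le_mul_of_nonneg_left h1 (by positivity))
  rw [Real.div_rpow (by positivity) hN.le, Real.div_rpow (by positivity) hN.le,
    Real.rpow_add hN, two_mul, Real.rpow_add hN, Real.rpow_one]
  push_cast
  have := Real.rpow_pos_of_pos hN α
  field_simp
  ring

/-- Only `i = 0` and `i = n` see that `a(0)` is `1` and not `0^α`; they account for the second term,
which is of lower order. -/
theorem convSum_le {α : ℝ} (hα : 0 < α) (n : ℕ) :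
    convSum α n ≤ ((n + 1 : ℕ) : ℝ) ^ (2 * α + 1) * IConst α + 2 * ((n + 1 : ℕ) : ℝ) ^ α := by
  have hb : ∀ i ∈ Finset.range (n + 1), aFun α i * aFun α (n - i) ≤
      (i : ℝ) ^ α * ((n - i : ℕ) : ℝ) ^ α +
        ((if i = 0 then ((n + 1 : ℕ) : ℝ) ^ α else 0) +
          (if i = n then ((n + 1 : ℕ) : ℝ) ^ α else 0)) := by
    intro i hi
    have hin : i ≤ n := by simpa [Nat.lt_succ_iff] using hi
    have hle : aFun α n ≤ ((n + 1 : ℕ) : ℝ) ^ α := by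
      rw [← aFun_of_pos n.succ_pos]
      exact aFun_mono hα.le n.le_succ
    have h0 : 0 ≤ (i : ℝ) ^ α * ((n - i : ℕ) : ℝ) ^ α := by positivity
    have hN : 0 ≤ ((n + 1 : ℕ) : ℝ) ^ α := by positivity
    rcases Nat.eq_zero_or_pos i with rfl | hi0
    · simp only [aFun_zero, one_mul, Nat.sub_zero, if_true] at h0 ⊢
      split_ifs <;> linarith
    · rcases hin.eq_or_lt with rfl | hlt
      · simp only [Nat.sub_self, aFun_zero, mul_one, if_true] at h0 ⊢
        split_ifs <;> linarith
      · rw [aFun_of_pos hi0, aFun_of_pos (by omega)]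
        simp [hi0.ne', hlt.ne]
  refine (Finset.sum_le_sum hb).trans ?_
  rw [Finset.sum_add_distrib, Finset.sum_add_distrib]
  refine add_le_add (sum_rpow_mul_rpow_le hα.le n) (le_of_eq ?_)
  simp
  ring

/-! ### The Dirichlet form as a superposition of Dirichlet forms of the walk -/

section walk

variable {S : Type*} [Fintype S] {r : S → S → ℝ} {m : S → ℝ}

theorem walkDirichlet_nonneg (hr : ∀ x y, 0 ≤ r x y) (hm : ∀ x, 0 ≤ m x) (f : S → ℝ) :
    0 ≤ walkDirichlet r m f := by
  refine mul_nonneg (by norm_num) (Finset.sum_nonneg fun x _ => Finset.sum_nonneg fun y _ => ?_)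
  exact mul_nonneg (mul_nonneg (hm x) (hr x y)) (sq_nonneg _)

theorem walkDirichlet_le_of_abs_le (hr : ∀ x y, 0 ≤ r x y) (hm : ∀ x, 0 ≤ m x) {f g : S → ℝ}
    {c : ℝ} (h : ∀ x y, |f x - f y| ≤ c * |g x - g y|) :
    walkDirichlet r m f ≤ c ^ 2 * walkDirichlet r m g := by
  rw [walkDirichlet, walkDirichlet, mul_left_comm]
  refine mul_le_mul_of_nonneg_left ?_ (by norm_num)
  rw [Finset.mul_sum]
  refine Finset.sum_le_sum fun x _ => ?_
  rw [Finset.mul_sum]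
  refine Finset.sum_le_sum fun y _ => ?_
  rw [mul_left_comm]
  refine mul_le_mul_of_nonneg_left ?_ (mul_nonneg (hm x) (hr x y))
  rw [← sq_abs (f y - f x), ← sq_abs (g y - g x), ← mul_pow]
  exact pow_le_pow_left₀ (abs_nonneg _) (h y x) 2

theorem walkCap_nonneg (hr : ∀ x y, 0 ≤ r x y) (hm : ∀ x, 0 ≤ m x) (x y : S) :
    0 ≤ walkCap r m x y := by
  refine Real.sInf_nonneg ?_
  rintro _ ⟨f, -, rfl⟩
  exact walkDirichlet_nonneg hr hm f

/-- Unless `f x = f y`, the affine normalization `(f - f y)/(f x - f y)` is admissible for the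
capacity, and the form is quadratic. -/
theorem walkCap_mul_sq_le (hr : ∀ x y, 0 ≤ r x y) (hm : ∀ x, 0 ≤ m x) (x y : S) (f : S → ℝ) :
    walkCap r m x y * (f x - f y) ^ 2 ≤ walkDirichlet r m f := by
  rcases eq_or_ne (f x - f y) 0 with h | h
  · rw [h]
    simpa using walkDirichlet_nonneg hr hm f
  · have h1 : walkCap r m x y ≤ walkDirichlet r m fun z => (f z - f y) / (f x - f y) := by
      refine csInf_le ⟨0, ?_⟩ ⟨_, ⟨by simp [h], by simp⟩, rfl⟩
      rintro _ ⟨g, -, rfl⟩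
      exact walkDirichlet_nonneg hr hm g
    have h2 : walkDirichlet r m (fun z => (f z - f y) / (f x - f y)) ≤
        ((|f x - f y|)⁻¹) ^ 2 * walkDirichlet r m f := by
      refine walkDirichlet_le_of_abs_le hr hm fun u v => le_of_eq ?_
      rw [← sub_div, abs_div, sub_sub_sub_cancel_right]
      ring
    have h3 := h1.trans h2
    rw [inv_pow, sq_abs, inv_mul_eq_div, le_div_iff₀ (by positivity)] at h3
    exact h3

variable [DecidableEq S] {α : ℝ}

theorem weight_addOne_mul_gFun (ξ : S → ℕ) (x : S) :
    weight α m (addOne ξ x) * gFun α (addOne ξ x x) = weight α m ξ * mStar m x := by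
  rw [weight, weight, ← Finset.mul_prod_erase _ _ (Finset.mem_univ x),
    ← Finset.mul_prod_erase _ (fun z => mStar m z ^ ξ z / aFun α (ξ z)) (Finset.mem_univ x),
    addOne_self]
  have : ∏ z ∈ Finset.univ.erase x, mStar m z ^ addOne ξ x z / aFun α (addOne ξ x z) =
      ∏ z ∈ Finset.univ.erase x, mStar m z ^ ξ z / aFun α (ξ z) :=
    Finset.prod_congr rfl fun z hz => by rw [addOne_of_ne ξ (Finset.ne_of_mem_erase hz)]
  rw [this, gFun, if_neg (Nat.succ_ne_zero _), Nat.add_sub_cancel]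
  have h1 := aFun_pos (α := α) (ξ x)
  have h2 := aFun_pos (α := α) (ξ x + 1)
  field_simp
  ring

theorem move_addOne (ξ : S → ℕ) {x y : S} (h : x ≠ y) :
    move x y (addOne ξ x) = addOne ξ y := by
  funext z
  by_cases hx : z = x
  · subst hx
    simp [move, addOne_self, addOne_of_ne ξ h]
  · by_cases hy : z = y
    · subst hy
      simp [move, hx, addOne_self, addOne_of_ne ξ hx]
    · simp [move, hx, hy, addOne_of_ne ξ hx, addOne_of_ne ξ hy]

/-- The jump from `x` to `y` at `η = ξ + e_x` leads to `ξ + e_y`. Grouping jumps by the remaining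
particles `ξ` therefore yields, for each `ξ`, a copy of the walk performed by one extra particle. -/
theorem zrDirichlet_eq (n : ℕ) (F : (S → ℕ) → ℝ) :
    zrDirichlet α r m (n + 1) F =
      ((n + 1 : ℕ) : ℝ) ^ α / (partitionZ α m (n + 1) * maxMass m) *
        ∑ ξ ∈ configs S n, weight α m ξ * walkDirichlet r m fun z => F (addOne ξ z) := by
  set c : ℝ := ((n + 1 : ℕ) : ℝ) ^ α / partitionZ α m (n + 1) with hc
  have key : ∀ x y, y ≠ x → ∑ η ∈ configs S (n + 1),
      invMeasure α m (n + 1) η * gFun α (η x) * r x y * (F (move x y η) - F η) ^ 2 =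
      ∑ ξ ∈ configs S n, c / maxMass m * weight α m ξ *
        (m x * r x y * (F (addOne ξ y) - F (addOne ξ x)) ^ 2) := by
    intro x y hxy
    symm
    refine Finset.sum_of_injOn (fun ξ => addOne ξ x) ?_ ?_ ?_ ?_
    · intro ξ _ η _ h
      exact add_right_cancel h
    · intro ξ hξ
      exact addOne_mem hξ x
    -- A configuration not of the form `ξ + e_x` has no particle at `x`, and then `g(0) = 0` kills
    -- its term.
    · intro η hη hne
      have : η x = 0 := by
        by_contra h0
        have hle : (Pi.single x 1 : S → ℕ) ≤ η := by
          intro z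
          by_cases hz : z = x
          · subst hz
            rw [Pi.single_eq_same]
            exact Nat.one_le_iff_ne_zero.2 h0
          · simp [hz]
        refine hne ⟨η - Pi.single x 1, ?_, ?_⟩
        · have h1 : addOne (η - Pi.single x 1) x = η := tsub_add_cancel_of_le hle
          have h2 : ∑ z, addOne (η - Pi.single x 1) x z = n + 1 := by
            rw [h1]; exact mem_configs.1 hη
          simp only [addOne, Pi.add_apply, Finset.sum_add_distrib] at h2
          rw [Finset.mem_coe, mem_configs]
          simpa using h2
        · exact tsub_add_cancel_of_le hle
      simp [this, gFun]
    · intro ξ _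
      rw [move_addOne ξ hxy.symm, invMeasure, ← hc]
      have := weight_addOne_mul_gFun (α := α) (m := m) ξ x
      calc c / maxMass m * weight α m ξ * (m x * r x y * (F (addOne ξ y) - F (addOne ξ x)) ^ 2)
          = c * (weight α m ξ * mStar m x) * r x y * (F (addOne ξ y) - F (addOne ξ x)) ^ 2 := by
            rw [mStar]; ring
        _ = _ := by rw [← this]; ring
  have h2 : zrDirichlet α r m (n + 1) F = 1 / 2 * ∑ x, ∑ y, ∑ ξ ∈ configs S n,
      c / maxMass m * weight α m ξ * (m x * r x y * (F (addOne ξ y) - F (addOne ξ x)) ^ 2) := by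
    rw [zrDirichlet]
    congr 1
    refine Finset.sum_congr rfl fun x _ => ?_
    -- The diagonal term `y = x` can be added freely, because its increment is zero.
    rw [← Finset.add_sum_erase _ (fun y => ∑ ξ ∈ configs S n, c / maxMass m * weight α m ξ *
      (m x * r x y * (F (addOne ξ y) - F (addOne ξ x)) ^ 2)) (Finset.mem_univ x)]
    rw [Finset.sum_congr rfl fun y hy => key x y (Finset.ne_of_mem_erase hy)]
    simp
  rw [h2, ← div_div, ← hc]
  simp only [walkDirichlet, Finset.mul_sum]
  rw [Finset.sum_comm' (s := Finset.univ) (t := fun _ => Finset.univ) (s' := fun _ => Finset.univ)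
    (t' := Finset.univ) (by simp)]
  rw [Finset.sum_comm]
  symm
  rw [Finset.sum_comm]
  refine Finset.sum_congr rfl fun y _ => ?_
  rw [Finset.sum_comm]
  refine Finset.sum_congr rfl fun x _ => ?_
  refine Finset.sum_congr rfl fun ξ _ => ?_
  ring

theorem zrDirichlet_nonneg (hr : ∀ x y, 0 ≤ r x y) (hm : ∀ x, 0 ≤ m x) (N : ℕ)
    (F : (S → ℕ) → ℝ) : 0 ≤ zrDirichlet α r m N F := by
  have hw := weight_nonneg (α := α) hm
  refine mul_nonneg (by norm_num) (Finset.sum_nonneg fun x _ => Finset.sum_nonneg fun y _ =>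
    Finset.sum_nonneg fun η _ => ?_)
  have h1 : 0 ≤ invMeasure α m N η := by
    refine mul_nonneg (div_nonneg (by positivity) ?_) (hw η)
    exact mul_nonneg (by positivity) (Finset.sum_nonneg fun ξ _ => hw ξ)
  have h2 : 0 ≤ gFun α (η x) := by
    rw [gFun]
    split_ifs
    · exact le_rfl
    · exact div_nonneg (aFun_pos _).le (aFun_pos _).le
  exact mul_nonneg (mul_nonneg (mul_nonneg h1 h2) (hr x y)) (sq_nonneg _)

end walk

/-! ### Lower bound for the Dirichlet form -/

section lower

variable {S : Type*} [Fintype S] [DecidableEq S] {α : ℝ} {r : S → S → ℝ} {m : S → ℝ}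

/-- The configuration `ζ` with `i` particles added at `x` and `j` particles added at `y`. -/
def addPair (ζ : S → ℕ) (x y : S) (i j : ℕ) : S → ℕ := ζ + Pi.single x i + Pi.single y j

theorem addPair_left {ζ : S → ℕ} {x y : S} (hxy : x ≠ y) (hx : ζ x = 0) (i j : ℕ) :
    addPair ζ x y i j x = i := by
  simp [addPair, hx, hxy]

theorem addPair_right {ζ : S → ℕ} {x y : S} (hxy : x ≠ y) (hy : ζ y = 0) (i j : ℕ) :
    addPair ζ x y i j y = j := by
  simp [addPair, hy, hxy.symm]

theorem addPair_of_ne (ζ : S → ℕ) {x y z : S} (hx : z ≠ x) (hy : z ≠ y) (i j : ℕ) :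
    addPair ζ x y i j z = ζ z := by
  simp [addPair, hx, hy]

theorem sum_addPair (ζ : S → ℕ) (x y : S) (i j : ℕ) :
    ∑ z, addPair ζ x y i j z = ∑ z, ζ z + i + j := by
  simp [addPair, Finset.sum_add_distrib]

theorem addOne_addPair_left (ζ : S → ℕ) (x y : S) (i j : ℕ) :
    addOne (addPair ζ x y i j) x = addPair ζ x y (i + 1) j := by
  rw [addOne, addPair, addPair, Pi.single_add]
  abel

theorem addOne_addPair_right (ζ : S → ℕ) (x y : S) (i j : ℕ) :
    addOne (addPair ζ x y i j) y = addPair ζ x y i (j + 1) := by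
  rw [addOne, addPair, addPair, Pi.single_add]
  abel

theorem clearOn_addPair {ζ : S → ℕ} {x y : S} (hx : ζ x = 0) (hy : ζ y = 0) (i j : ℕ) :
    clearOn {x, y} (addPair ζ x y i j) = ζ := by
  funext z
  by_cases hzx : z = x
  · subst hzx; simp [clearOn, hx]
  · by_cases hzy : z = y
    · subst hzy; simp [clearOn, hy]
    · simp [clearOn, hzx, hzy, addPair_of_ne]

theorem weight_eq_clearOn_pair (hM : 0 < maxMass m) {x y : S} (hxy : x ≠ y)
    (hx : x ∈ maxSites m) (hy : y ∈ maxSites m) (ξ : S → ℕ) :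
    weight α m ξ = weight α m (clearOn {x, y} ξ) / (aFun α (ξ x) * aFun α (ξ y)) := by
  rw [weight_eq_clearOn {x, y} ξ, Finset.prod_pair hxy, mStar_eq_one hM hx, mStar_eq_one hM hy,
    one_pow, one_pow, div_mul_div_comm, one_mul, mul_one_div]

/-- Along the segment of configurations joining two wells, the Dirichlet form is at least the
effective conductance between the wells. -/
theorem walkCap_mul_weight_le (hα : 0 ≤ α) (hr : ∀ x y, 0 ≤ r x y) (hm : ∀ x, 0 ≤ m x)
    (hM : 0 < maxMass m) {x y : S} (hxy : x ≠ y) (hx : x ∈ maxSites m) (hy : y ∈ maxSites m)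
    {K n : ℕ} (hn : Fintype.card S * K + (2 * K + 1) ≤ n) {ζ : S → ℕ} (hζ : ζ ∈ box {x, y} K)
    {F : (S → ℕ) → ℝ}
    (h1 : F (addPair ζ x y (n - ∑ z, ζ z - K) (K + 1)) = 1)
    (h0 : F (addPair ζ x y (K + 1) (n - ∑ z, ζ z - K)) = 0) :
    walkCap r m x y * weight α m ζ ≤ convSum α n *
      ∑ l ∈ Finset.range (n - ∑ z, ζ z - (2 * K + 1)),
        weight α m (addPair ζ x y (K + 1 + l) (n - ∑ z, ζ z - (K + 1 + l))) *
          walkDirichlet r m fun z =>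
            F (addOne (addPair ζ x y (K + 1 + l) (n - ∑ z, ζ z - (K + 1 + l))) z) := by
  have hζx := (mem_box.1 hζ).1 x (by simp)
  have hζy := (mem_box.1 hζ).1 y (by simp)
  have hk := sum_le_of_mem_box hζ
  set k := ∑ z, ζ z
  set L := n - k - (2 * K + 1) with hL
  -- The configurations here have `n + 1` particles, and `f l`, `f (l + 1)` are the values of `F` at
  -- `ξ + e_y` and `ξ + e_x` for the same `ξ` of `n` particles. Starting at `K + 1` and making `L`
  -- steps keeps more than `K` particles of `ξ` at both `x` and `y`, so that the two sites can be
  -- recovered from `ξ`.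
  let f : ℕ → ℝ := fun l => F (addPair ζ x y (K + 1 + l) (n - k + 1 - (K + 1 + l)))
  have hf0 : f 0 = 0 := by
    rw [← h0]
    simp only [f]
    congr 2
    omega
  have hfL : f L = 1 := by
    rw [← h1]
    simp only [f]
    congr 2 <;> omega
  have htel := Finset.sum_range_sub f L
  rw [hf0, hfL, sub_zero] at htel
  let A : ℕ → ℝ := fun l => aFun α (K + 1 + l) * aFun α (n - k - (K + 1 + l))
  have hA : ∀ l, 0 < A l := fun l => mul_pos (aFun_pos _) (aFun_pos _)
  -- The series law: the increments of `f` add up to `1`, and the edges have resistances `A l`.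
  have hCS := Finset.sum_sq_le_sum_mul_sum_of_sq_le_mul (Finset.range L)
    (r := fun l => f (l + 1) - f l) (f := A) (g := fun l => (f (l + 1) - f l) ^ 2 / A l)
    (fun l _ => (hA l).le) (fun l _ => div_nonneg (sq_nonneg _) (hA l).le)
    (fun l _ => by have := hA l; field_simp; exact le_rfl)
  rw [htel, one_pow] at hCS
  have hAle : ∑ l ∈ Finset.range L, A l ≤ convSum α n := by
    refine sum_le_sum_of_injOn (fun l => K + 1 + l) (fun a _ b _ h => by simpa using h) ?_ ?_ ?_
    · intro l hl
      simp only [Finset.mem_range] at hl ⊢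
      omega
    · intro l _
      exact mul_le_mul_of_nonneg_left (aFun_mono hα (by omega)) (aFun_pos _).le
    · intro i _
      exact (mul_pos (aFun_pos _) (aFun_pos _)).le
  have hterm : ∀ l ∈ Finset.range L,
      walkCap r m x y * weight α m ζ * ((f (l + 1) - f l) ^ 2 / A l) ≤
        weight α m (addPair ζ x y (K + 1 + l) (n - k - (K + 1 + l))) *
          walkDirichlet r m fun z => F (addOne (addPair ζ x y (K + 1 + l)
            (n - k - (K + 1 + l))) z) := by
    intro l hl
    rw [Finset.mem_range] at hl
    rw [weight_eq_clearOn_pair hM hxy hx hy (addPair _ _ _ _ _), clearOn_addPair hζx hζy, addPair_left hxy hζx,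
      addPair_right hxy hζy]
    have h2 := walkCap_mul_sq_le hr hm x y
      (fun z => F (addOne (addPair ζ x y (K + 1 + l) (n - k - (K + 1 + l))) z))
    simp only [addOne_addPair_left, addOne_addPair_right] at h2
    have h3 : f (l + 1) = F (addPair ζ x y (K + 1 + l + 1) (n - k - (K + 1 + l))) := by
      simp only [f]
      congr 2
      omega
    have h4 : f l = F (addPair ζ x y (K + 1 + l) (n - k - (K + 1 + l) + 1)) := by
      simp only [f]
      congr 2
      omega
    rw [← h3, ← h4] at h2
    have h5 : 0 ≤ weight α m ζ / A l := div_nonneg (weight_nonneg hm ζ) (hA l).le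
    refine le_trans (le_of_eq ?_) (mul_le_mul_of_nonneg_left h2 h5)
    ring
  have hwc : 0 ≤ walkCap r m x y * weight α m ζ :=
    mul_nonneg (walkCap_nonneg hr hm x y) (weight_nonneg hm ζ)
  have hs : 0 ≤ ∑ l ∈ Finset.range L, (f (l + 1) - f l) ^ 2 / A l :=
    Finset.sum_nonneg fun l _ => div_nonneg (sq_nonneg _) (hA l).le
  calc walkCap r m x y * weight α m ζ
      ≤ walkCap r m x y * weight α m ζ *
        (convSum α n * ∑ l ∈ Finset.range L, (f (l + 1) - f l) ^ 2 / A l) :=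
        le_mul_of_one_le_right hwc (hCS.trans (mul_le_mul_of_nonneg_right hAle hs))
    _ = convSum α n * ∑ l ∈ Finset.range L,
          walkCap r m x y * weight α m ζ * ((f (l + 1) - f l) ^ 2 / A l) := by
        rw [← Finset.mul_sum]; ring
    _ ≤ _ := mul_le_mul_of_nonneg_left (Finset.sum_le_sum hterm) (convSum_pos α n).le

/-- `∑_{x ∈ S₁, y ∈ S⋆ \ S₁} Cap_S(x,y) ∏_{z ≠ x, y} ∑_{j ≤ K} m⋆(z)^j / a(j)`. -/
def partCapSum (α : ℝ) (r : S → S → ℝ) (m : S → ℝ) (S₁ : Finset S) (K : ℕ) : ℝ :=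
  ∑ p ∈ S₁ ×ˢ (maxSites m \ S₁),
    walkCap r m p.1 p.2 * ∏ z ∈ Finset.univ \ {p.1, p.2}, partGamma α m K z

/-- The one-segment bounds may be added because the segments are disjoint. The slack `|S| K + K + 1`
in the hypotheses covers what the end of a segment lacks at its main site: the background, `K`, and
one more. -/
theorem partCapSum_le (hα : 0 ≤ α) (hr : ∀ x y, 0 ≤ r x y) (hm : ∀ x, 0 ≤ m x)
    (hM : 0 < maxMass m) {S₁ : Finset S} (hS₁ : S₁ ⊆ maxSites m)
    {K n : ℕ} (hn : Fintype.card S * K + (2 * K + 1) ≤ n) {F : (S → ℕ) → ℝ}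
    (h1 : ∀ x ∈ S₁, ∀ η ∈ configs S (n + 1), n + 1 ≤ η x + (Fintype.card S * K + K + 1) →
      (∀ z ∉ maxSites m, η z ≤ K) → F η = 1)
    (h0 : ∀ x ∈ maxSites m \ S₁, ∀ η ∈ configs S (n + 1),
      n + 1 ≤ η x + (Fintype.card S * K + K + 1) → (∀ z ∉ maxSites m, η z ≤ K) → F η = 0) :
    partCapSum α r m S₁ K ≤ convSum α n *
      ∑ ξ ∈ configs S n, weight α m ξ * walkDirichlet r m fun z => F (addOne ξ z) := by
  have hp : ∀ p ∈ S₁ ×ˢ (maxSites m \ S₁), p.1 ∈ S₁ ∧ p.1 ∈ maxSites m ∧ p.2 ∈ maxSites m ∧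
      p.2 ∉ S₁ ∧ p.1 ≠ p.2 := by
    intro p hp
    obtain ⟨h1, h2⟩ := Finset.mem_product.1 hp
    obtain ⟨h2, h3⟩ := Finset.mem_sdiff.1 h2
    exact ⟨h1, hS₁ h1, h2, h3, fun h => h3 (h ▸ h1)⟩
  let e : (Σ _ : S × S, Σ _ : S → ℕ, ℕ) → S → ℕ := fun q =>
    addPair q.2.1 q.1.1 q.1.2 (K + 1 + q.2.2) (n - ∑ z, q.2.1 z - (K + 1 + q.2.2))
  let G : (S → ℕ) → ℝ := fun ξ => weight α m ξ * walkDirichlet r m fun z => F (addOne ξ z)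
  have hpart : ∀ p ∈ S₁ ×ˢ (maxSites m \ S₁), ∀ ζ ∈ box {p.1, p.2} K,
      walkCap r m p.1 p.2 * weight α m ζ ≤ convSum α n *
        ∑ l ∈ Finset.range (n - ∑ z, ζ z - (2 * K + 1)), G (e ⟨p, ζ, l⟩) := by
    intro p hpm ζ hζ
    obtain ⟨hp1, hx, hy, hp2, hne⟩ := hp p hpm
    have hζx := (mem_box.1 hζ).1 p.1 (by simp)
    have hζy := (mem_box.1 hζ).1 p.2 (by simp)
    have hk := sum_le_of_mem_box hζ
    have hout : ∀ i j, ∀ z ∉ maxSites m, addPair ζ p.1 p.2 i j z ≤ K := by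
      intro i j z hz
      have hz1 : z ≠ p.1 := fun h => hz (h ▸ hx)
      have hz2 : z ≠ p.2 := fun h => hz (h ▸ hy)
      rw [addPair_of_ne ζ hz1 hz2]
      exact (mem_box.1 hζ).2 z (by simp [hz1, hz2])
    refine walkCap_mul_weight_le hα hr hm hM hne hx hy hn hζ ?_ ?_
    · refine h1 p.1 hp1 _ ?_ ?_ (hout _ _)
      · rw [mem_configs, sum_addPair]
        omega
      · rw [addPair_left hne hζx]
        omega
    · refine h0 p.2 (Finset.mem_sdiff.2 ⟨hy, hp2⟩) _ ?_ ?_ (hout _ _)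
      · rw [mem_configs, sum_addPair]
        omega
      · rw [addPair_right hne hζy]
        omega
  have hsum : partCapSum α r m S₁ K ≤ convSum α n *
      ∑ q ∈ (S₁ ×ˢ (maxSites m \ S₁)).sigma fun p => (box {p.1, p.2} K).sigma fun ζ =>
        Finset.range (n - ∑ z, ζ z - (2 * K + 1)), G (e q) := by
    rw [Finset.sum_sigma, partCapSum, Finset.mul_sum]
    refine Finset.sum_le_sum fun p hpm => ?_
    rw [Finset.sum_sigma, ← sum_box_weight, Finset.mul_sum, Finset.mul_sum]
    exact Finset.sum_le_sum fun ζ hζ => hpart p hpm ζ hζ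
  refine hsum.trans (mul_le_mul_of_nonneg_left ?_ (convSum_pos α n).le)
  have hmem : ∀ q ∈ (S₁ ×ˢ (maxSites m \ S₁)).sigma fun p => (box {p.1, p.2} K).sigma fun ζ =>
      Finset.range (n - ∑ z, ζ z - (2 * K + 1)),
      e q ∈ configs S n ∧ clearOn {q.1.1, q.1.2} (e q) = q.2.1 ∧ e q q.1.1 = K + 1 + q.2.2 ∧
        K < e q q.1.2 ∧ (∀ z, z ≠ q.1.1 → z ≠ q.1.2 → e q z ≤ K) := by
    rintro ⟨p, ζ, l⟩ hq
    simp only [Finset.mem_sigma, Finset.mem_range] at hq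
    obtain ⟨hpm, hζ, hl⟩ := hq
    obtain ⟨hp1, hx, hy, hp2, hne⟩ := hp p hpm
    have hζx := (mem_box.1 hζ).1 p.1 (by simp)
    have hζy := (mem_box.1 hζ).1 p.2 (by simp)
    have hk := sum_le_of_mem_box hζ
    refine ⟨?_, clearOn_addPair hζx hζy _ _, addPair_left hne hζx _ _, ?_, ?_⟩
    · rw [mem_configs, sum_addPair]
      dsimp only
      omega
    · simp only [e]
      rw [addPair_right hne hζy]
      omega
    · intro z hz1 hz2
      simp only [e]
      rw [addPair_of_ne ζ hz1 hz2]
      exact (mem_box.1 hζ).2 z (by simp [hz1, hz2])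
  refine sum_le_sum_of_injOn (g := G) e ?_ (fun q hq => (hmem q hq).1) (fun q _ => le_rfl)
    fun ξ _ => mul_nonneg (weight_nonneg hm ξ) (walkDirichlet_nonneg hr hm _)
  intro q hq q' hq' hqq
  rw [Finset.mem_coe] at hq hq'
  have a := hmem q hq
  have b := hmem q' hq'
  have hpq := hp _ (Finset.mem_sigma.1 hq).1
  have hpq' := hp _ (Finset.mem_sigma.1 hq').1
  rw [← hqq] at b
  -- Exactly the two endpoints hold more than `K` particles, and membership in `S₁` tells which one
  -- comes first.
  have hx : q.1.1 = q'.1.1 := by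
    by_contra hne
    have h2 : q.1.1 ≠ q'.1.2 := fun h => hpq'.2.2.2.1 (h ▸ hpq.1)
    have := b.2.2.2.2 _ hne h2
    have := a.2.2.1
    omega
  have hy : q.1.2 = q'.1.2 := by
    by_contra hne
    have h2 : q.1.2 ≠ q'.1.1 := fun h => hpq.2.2.2.1 (h ▸ hpq'.1)
    have := b.2.2.2.2 _ h2 hne
    have := a.2.2.2.1
    omega
  have hζ := a.2.1
  rw [hx, hy, b.2.1] at hζ
  have hl := a.2.2.1
  rw [hx, b.2.2.1] at hl
  obtain ⟨⟨x, y⟩, ζ, l⟩ := q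
  obtain ⟨⟨x', y'⟩, ζ', l'⟩ := q'
  simp only at hx hy hζ hl
  subst hx hy hζ
  obtain rfl : l' = l := by omega
  rfl

end lower

/-! ### The profile of the test function -/

section profile

variable {α : ℝ}

/-- The function `u^α (1-u)^α` on `[0,1]`, extended by `0`. -/
def bump (α u : ℝ) : ℝ := max u 0 ^ α * max (1 - u) 0 ^ α

theorem continuous_bump (hα : 0 ≤ α) : Continuous (bump α) :=
  ((continuous_id.max continuous_const).rpow_const fun _ => Or.inr hα).mul
    (((continuous_const.sub continuous_id).max continuous_const).rpow_const fun _ => Or.inr hα)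

theorem bump_nonneg (u : ℝ) : 0 ≤ bump α u := by
  unfold bump
  positivity

theorem bump_of_le_zero (hα : 0 < α) {u : ℝ} (hu : u ≤ 0) : bump α u = 0 := by
  simp [bump, max_eq_right hu, Real.zero_rpow hα.ne']

theorem bump_of_one_le (hα : 0 < α) {u : ℝ} (hu : 1 ≤ u) : bump α u = 0 := by
  simp [bump, max_eq_right (sub_nonpos.2 hu), Real.zero_rpow hα.ne']

theorem bump_le (hα : 0 ≤ α) {u p q : ℝ} (hp : 0 ≤ p) (hq : 0 ≤ q) (h1 : u ≤ p)
    (h2 : 1 - u ≤ q) : bump α u ≤ p ^ α * q ^ α :=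
  mul_le_mul (Real.rpow_le_rpow (le_max_right _ _) (max_le h1 hp) hα)
    (Real.rpow_le_rpow (le_max_right _ _) (max_le h2 hq) hα) (by positivity) (by positivity)

theorem bump_le_one (hα : 0 < α) (u : ℝ) : bump α u ≤ 1 := by
  rcases le_total u 0 with h | h
  · rw [bump_of_le_zero hα h]; exact zero_le_one
  · rcases le_total 1 u with h' | h'
    · rw [bump_of_one_le hα h']; exact zero_le_one
    · simpa using bump_le hα.le zero_le_one zero_le_one h' (sub_le_self 1 h)

/-- The normalized primitive of `u^α (1-u)^α`, constant on both sides of `[0,1]`. -/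
def primitive (α v : ℝ) : ℝ := (∫ u in (0 : ℝ)..v, bump α u) / IConst α

theorem integral_bump : ∫ u in (0 : ℝ)..1, bump α u = IConst α := by
  refine intervalIntegral.integral_congr fun u hu => ?_
  rw [Set.uIcc_of_le zero_le_one] at hu
  simp [bump, max_eq_left hu.1, max_eq_left (sub_nonneg.2 hu.2)]

theorem integral_bump_eq_zero {a b : ℝ} (h : ∀ u ∈ Set.uIcc a b, bump α u = 0) :
    ∫ u in a..b, bump α u = 0 := by
  rw [intervalIntegral.integral_congr (g := fun _ => (0 : ℝ)) h]
  simp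

theorem primitive_sub (hα : 0 ≤ α) (a b : ℝ) :
    primitive α b - primitive α a = (∫ u in a..b, bump α u) / IConst α := by
  have hi : ∀ a b, IntervalIntegrable (bump α) MeasureTheory.volume a b :=
    fun a b => (continuous_bump hα).intervalIntegrable a b
  rw [primitive, primitive, ← sub_div, intervalIntegral.integral_interval_sub_left (hi _ _) (hi _ _)]

theorem primitive_of_le_zero (hα : 0 < α) {v : ℝ} (hv : v ≤ 0) : primitive α v = 0 := by
  rw [primitive, integral_bump_eq_zero, zero_div]
  intro u hu
  rw [Set.uIcc_of_ge hv] at hu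
  exact bump_of_le_zero hα hu.2

theorem primitive_one (hα : 0 ≤ α) : primitive α 1 = 1 := by
  rw [primitive, integral_bump, div_self (IConst_pos hα).ne']

theorem primitive_of_one_le (hα : 0 < α) {v : ℝ} (hv : 1 ≤ v) : primitive α v = 1 := by
  have h := primitive_sub hα.le 1 v
  rw [integral_bump_eq_zero, zero_div, primitive_one hα.le] at h
  · linarith
  · intro u hu
    rw [Set.uIcc_of_le hv] at hu
    exact bump_of_one_le hα hu.1

theorem primitive_mono (hα : 0 ≤ α) : Monotone (primitive α) := by
  intro a b hab
  rw [← sub_nonneg, primitive_sub hα]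
  exact div_nonneg (intervalIntegral.integral_nonneg hab fun u _ => bump_nonneg u)
    (IConst_pos hα).le

theorem abs_primitive_sub_le (hα : 0 ≤ α) {a b c : ℝ} (h : ∀ u ∈ Set.uIcc a b, bump α u ≤ c) :
    |primitive α b - primitive α a| ≤ c * |b - a| / IConst α := by
  rw [primitive_sub hα, abs_div, abs_of_pos (IConst_pos hα)]
  have := intervalIntegral.norm_integral_le_of_norm_le_const (a := a) (b := b) (C := c)
    (f := bump α) fun u hu => by
      rw [Real.norm_eq_abs, abs_of_nonneg (bump_nonneg u)]
      exact h u (Set.uIoc_subset_uIcc hu)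
  rw [Real.norm_eq_abs] at this
  exact div_le_div_of_nonneg_right this (IConst_pos hα).le

/-- The profile of the test function: it is `0` up to `ε` and `1` from `1 - ε` on. -/
def profile (α ε t : ℝ) : ℝ := primitive α ((t - ε) / (1 - 2 * ε))

variable {ε : ℝ}

theorem profile_eq_zero (hα : 0 < α) (hε : ε ≤ 1 / 4) {t : ℝ} (ht : t ≤ ε) :
    profile α ε t = 0 :=
  primitive_of_le_zero hα (div_nonpos_of_nonpos_of_nonneg (by linarith) (by linarith))

theorem profile_eq_one (hα : 0 < α) (hε : ε ≤ 1 / 4) {t : ℝ} (ht : 1 - ε ≤ t) :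
    profile α ε t = 1 :=
  primitive_of_one_le hα ((one_le_div (by linarith)).2 (by linarith))

theorem profile_nonneg (hα : 0 < α) (t : ℝ) : 0 ≤ profile α ε t := by
  rw [← primitive_of_le_zero hα (min_le_right ((t - ε) / (1 - 2 * ε)) 0)]
  exact primitive_mono hα.le (min_le_left _ _)

theorem profile_le_one (hα : 0 < α) (t : ℝ) : profile α ε t ≤ 1 := by
  rw [← primitive_of_one_le hα (le_max_right ((t - ε) / (1 - 2 * ε)) 1)]
  exact primitive_mono hα.le (le_max_left _ _)

theorem abs_profile_sub_profile_le_one (hα : 0 < α) {ε' : ℝ} (s t : ℝ) :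
    |profile α ε s - profile α ε' t| ≤ 1 := by
  rw [abs_le]
  constructor <;> linarith [profile_nonneg (ε := ε) hα s, profile_nonneg (ε := ε') hα t,
    profile_le_one (ε := ε) hα s, profile_le_one (ε := ε') hα t]

theorem abs_profile_sub_le (hα : 0 < α) (hε : ε ≤ 1 / 4) (s t : ℝ) :
    |profile α ε t - profile α ε s| ≤ 1 / (IConst α * (1 - 2 * ε)) * |t - s| := by
  have h := abs_primitive_sub_le hα.le (a := (s - ε) / (1 - 2 * ε)) (b := (t - ε) / (1 - 2 * ε))
    fun u _ => bump_le_one hα u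
  have hpos : 0 < 1 - 2 * ε := by linarith
  refine h.trans (le_of_eq ?_)
  rw [← sub_div, sub_sub_sub_cancel_right, abs_div, abs_of_pos hpos]
  have := IConst_pos hα.le
  field_simp

/-- The margin `ε` lost at both ends of `[0,1]` absorbs the background: the slope is bounded through
`p` and `q`, which will be the exact fractions of particles at the two endpoints. The price is a
factor `(1-2ε)^(-α)` for each power and one more `(1-2ε)^(-1)` from rescaling the increment. -/
theorem abs_profile_sub_le_of_le (hα : 0 < α) (hε : ε ≤ 1 / 4) {s t p q : ℝ} (hp : 0 ≤ p)
    (hq : 0 ≤ q) (hs : s ≤ p + ε) (ht : t ≤ p + ε) (hs' : 1 - ε ≤ s + q) (ht' : 1 - ε ≤ t + q) :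
    |profile α ε t - profile α ε s| ≤
      p ^ α * q ^ α / (IConst α * (1 - 2 * ε) ^ (2 * α + 1)) * |t - s| := by
  have hpos : 0 < 1 - 2 * ε := by linarith
  have hI := IConst_pos hα.le
  have h := abs_primitive_sub_le hα.le (a := (s - ε) / (1 - 2 * ε)) (b := (t - ε) / (1 - 2 * ε))
    (c := (p / (1 - 2 * ε)) ^ α * (q / (1 - 2 * ε)) ^ α) fun u hu => by
      refine bump_le hα.le (by positivity) (by positivity) ?_ ?_
      · refine hu.2.trans (max_le ?_ ?_) <;>
        exact div_le_div_of_nonneg_right (by linarith) hpos.le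
      · rw [le_div_iff₀ hpos]
        have h1 : min ((s - ε) / (1 - 2 * ε)) ((t - ε) / (1 - 2 * ε)) ≤ u := hu.1
        rcases min_le_iff.1 h1 with h1 | h1 <;> rw [div_le_iff₀ hpos] at h1 <;> linarith
  refine h.trans (le_of_eq ?_)
  rw [← sub_div, sub_sub_sub_cancel_right, abs_div, abs_of_pos hpos, Real.div_rpow hp hpos.le,
    Real.div_rpow hq hpos.le, Real.rpow_add hpos, two_mul α, Real.rpow_add hpos, Real.rpow_one]
  have := Real.rpow_pos_of_pos hpos α
  field_simp

end profile

/-! ### The test function -/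

/-- McShane's extension for an indexed family. Points may repeat, and the hypothesis at distance
zero forces their values to agree. -/
theorem exists_lipschitz_extension {ι X : Type*} [PseudoMetricSpace X] (P : ι → X) (v : ι → ℝ)
    {L : ℝ} (hL : 0 ≤ L) (h : ∀ i j, |v i - v j| ≤ L * dist (P i) (P j)) :
    ∃ F : X → ℝ, (∀ i, F (P i) = v i) ∧ ∀ a b, |F a - F b| ≤ L * dist a b := by
  classical
  let f : X → ℝ := fun a => if ha : ∃ i, P i = a then v ha.choose else 0
  have hf : ∀ i, f (P i) = v i := by
    intro i
    have ha : ∃ j, P j = P i := ⟨i, rfl⟩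
    have h1 := h ha.choose i
    rw [ha.choose_spec, dist_self, mul_zero] at h1
    simp only [f, dif_pos ha]
    exact sub_eq_zero.1 (abs_nonpos_iff.1 h1)
  have hlip : LipschitzOnWith (Real.toNNReal L) f (Set.range P) := by
    refine LipschitzOnWith.of_dist_le_mul ?_
    rintro _ ⟨i, rfl⟩ _ ⟨j, rfl⟩
    rw [Real.dist_eq, hf, hf, Real.coe_toNNReal L hL]
    exact h i j
  obtain ⟨F, hF, hFf⟩ := hlip.extend_real
  refine ⟨F, fun i => ?_, fun a b => ?_⟩
  · rw [← hFf ⟨i, rfl⟩, hf]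
  · have := hF.dist_le_mul a b
    rwa [Real.dist_eq, Real.coe_toNNReal L hL] at this

section testFun

variable {S : Type*} [Fintype S] [DecidableEq S] {α ε : ℝ} {N : ℕ}

/-- The profile evaluated at the mean of `h` under the empirical measure `η / N`. -/
def tubeFun (α ε : ℝ) (N : ℕ) (h : S → ℝ) (η : S → ℕ) : ℝ :=
  profile α ε ((∑ z, h z * η z) / N)

theorem abs_tubeFun_sub_le (hα : 0 < α) (hε : ε ≤ 1 / 4) (hN : 0 < N) {h : S → ℝ}
    (h0 : ∀ z, 0 ≤ h z) (h1 : ∀ z, h z ≤ 1) (η ξ : S → ℕ) :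
    |tubeFun α ε N h η - tubeFun α ε N h ξ| ≤
      Fintype.card S / (IConst α * (1 - 2 * ε)) / N * dist η ξ := by
  have hN' : 0 < (N : ℝ) := by exact_mod_cast hN
  have hC : 0 < IConst α * (1 - 2 * ε) := mul_pos (IConst_pos hα.le) (by linarith)
  refine (abs_profile_sub_le hα hε _ _).trans ?_
  rw [← sub_div, abs_div, abs_of_pos hN', ← Finset.sum_sub_distrib]
  have hs : |∑ z, (h z * (η z : ℝ) - h z * (ξ z : ℝ))| ≤ Fintype.card S * dist η ξ := by
    refine (Finset.abs_sum_le_sum_abs _ _).trans ?_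
    have : ∀ z ∈ Finset.univ, |h z * (η z : ℝ) - h z * (ξ z : ℝ)| ≤ dist η ξ := by
      intro z _
      rw [← mul_sub, abs_mul, abs_of_nonneg (h0 z)]
      refine (mul_le_of_le_one_left (abs_nonneg _) (h1 z)).trans ?_
      rw [← Nat.dist_eq]
      exact dist_le_pi_dist η ξ z
    simpa using Finset.sum_le_card_nsmul _ _ _ this
  calc 1 / (IConst α * (1 - 2 * ε)) * (|∑ z, (h z * (η z : ℝ) - h z * (ξ z : ℝ))| / N)
      ≤ 1 / (IConst α * (1 - 2 * ε)) * (Fintype.card S * dist η ξ / N) := by gcongr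
    _ = _ := by ring

/-- The mean of `h` is within `ε` of `h x`, where the profile is already flat. -/
theorem tubeFun_eq_of_near (hα : 0 < α) (hε : ε ≤ 1 / 4) (hN : 0 < N) {h : S → ℝ}
    (h0 : ∀ z, 0 ≤ h z) (h1 : ∀ z, h z ≤ 1) {η : S → ℕ} (hη : η ∈ configs S N) {x : S}
    (hx : (1 - ε) * N ≤ η x) (hc : h x = 0 ∨ h x = 1) : tubeFun α ε N h η = h x := by
  have hN' : 0 < (N : ℝ) := by exact_mod_cast hN
  have hsum : ∑ z, (η z : ℝ) = N := by exact_mod_cast mem_configs.1 hη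
  rcases hc with hc | hc
  · rw [hc]
    refine profile_eq_zero hα hε ?_
    rw [div_le_iff₀ hN']
    have h2 : ∑ z, h z * (η z : ℝ) ≤ ∑ z ∈ Finset.univ.erase x, (η z : ℝ) := by
      rw [← Finset.add_sum_erase _ _ (Finset.mem_univ x), hc, zero_mul, zero_add]
      exact Finset.sum_le_sum fun z _ => mul_le_of_le_one_left (by positivity) (h1 z)
    have h3 := Finset.add_sum_erase Finset.univ (fun z => (η z : ℝ)) (Finset.mem_univ x)
    linarith
  · rw [hc]
    refine profile_eq_one hα hε ?_
    rw [le_div_iff₀ hN']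
    have h2 := Finset.single_le_sum (f := fun z => h z * (η z : ℝ))
      (fun z _ => mul_nonneg (h0 z) (by positivity)) (Finset.mem_univ x)
    simp only [hc, one_mul] at h2
    linarith

theorem le_dist_of_le_sub {η ξ : S → ℕ} {c : ℝ} (z : S) (h : c ≤ (η z : ℝ) - ξ z) :
    c ≤ dist η ξ := by
  refine (h.trans (le_abs_self _)).trans ?_
  rw [← Nat.dist_eq]
  exact dist_le_pi_dist η ξ z

/-- Boundary data on the sites of `A` and, for each pair of sites of `A`, an interpolation of these
data with values in `[0,1]`. -/
structure Interpolation (A : Finset S) where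
  /-- The value at each site. -/
  c : S → ℝ
  /-- The interpolating functions. -/
  H : S → S → S → ℝ
  c_eq : ∀ x, c x = 0 ∨ c x = 1
  symm : ∀ x y, H x y = H y x
  nonneg : ∀ x y z, 0 ≤ H x y z
  le_one : ∀ x y z, H x y z ≤ 1
  left : ∀ x ∈ A, ∀ y ∈ A, H x y x = c x
  const : ∀ x ∈ A, ∀ y ∈ A, c x = c y → ∀ z, H x y z = c x

namespace Interpolation

variable {A : Finset S} (I : Interpolation A)

theorem right {x y : S} (hx : x ∈ A) (hy : y ∈ A) : I.H x y y = I.c y := by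
  rw [I.symm]
  exact I.left y hy x hx

theorem tubeFun_near (hα : 0 < α) (hε : ε ≤ 1 / 4) (hN : 0 < N) {x y : S} (hx : x ∈ A)
    (hy : y ∈ A) {η : S → ℕ} (hη : η ∈ configs S N) (h : (1 - ε) * N ≤ η x) :
    tubeFun α ε N (I.H x y) η = I.c x := by
  have hc := I.left x hx y hy
  rw [tubeFun_eq_of_near hα hε hN (I.nonneg x y) (I.le_one x y) hη h (by rw [hc]; exact I.c_eq x),
    hc]

/-- The Lipschitz constant of the test function. -/
def lipConst (S : Type*) [Fintype S] (α ε δ : ℝ) : ℝ :=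
  Fintype.card S / (IConst α * (1 - 2 * ε)) + 1 / δ

theorem lipConst_nonneg (hα : 0 < α) (hε : ε ≤ 1 / 4) {δ : ℝ} (hδ : 0 < δ) :
    0 ≤ lipConst S α ε δ := by
  have : 0 < IConst α * (1 - 2 * ε) := mul_pos (IConst_pos hα.le) (by linarith)
  unfold lipConst
  positivity

theorem abs_tubeFun_sub_tubeFun_le (hα : 0 < α) (hε : ε ≤ 1 / 4) (hN : 0 < N) {δ : ℝ} (hδ : 0 < δ)
    (x y : S) (η ξ : S → ℕ) :
    |tubeFun α ε N (I.H x y) η - tubeFun α ε N (I.H x y) ξ| ≤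
      lipConst S α ε δ / N * dist η ξ := by
  refine (abs_tubeFun_sub_le hα hε hN (I.nonneg x y) (I.le_one x y) η ξ).trans ?_
  have : 0 ≤ 1 / δ := by positivity
  gcongr
  unfold lipConst
  linarith

/-- Here `x` is not an endpoint of the second tube. If `η_x ≥ 2δN`, then `ξ_x ≤ δN` puts the points
at distance at least `δN`, and the term `1/δ` of the constant suffices as both values lie in
`[0,1]`. Otherwise `η_y ≥ (1-ε)N`, where the value is `c y` in any tube ending at `y`. If `y` is an
endpoint of the second tube, both values come from that one tube function; if not, `ξ_y ≤ δN` and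
the points are again far apart. -/
theorem abs_tubeFun_sub_tubeFun_le_of_not_mem (hα : 0 < α) (hε : ε ≤ 1 / 4) (hN : 0 < N) {δ : ℝ}
    (hδ : 0 < δ) (hδε : (Fintype.card S + 2) * δ ≤ ε) {x y x' y' : S} (hx : x ∈ A) (hy : y ∈ A)
    (hx' : x' ∈ A) (hy' : y' ∈ A) (hxy : x ≠ y) {η ξ : S → ℕ} (hη : η ∈ configs S N)
    (hηT : ∀ z, z ≠ x → z ≠ y → (η z : ℝ) ≤ δ * N)
    (hξT : ∀ z, z ≠ x' → z ≠ y' → (ξ z : ℝ) ≤ δ * N) (h1 : x ≠ x') (h2 : x ≠ y') :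
    |tubeFun α ε N (I.H x y) η - tubeFun α ε N (I.H x' y') ξ| ≤
      lipConst S α ε δ / N * dist η ξ := by
  have hN' : 0 < (N : ℝ) := by exact_mod_cast hN
  have hfar : δ * N ≤ dist η ξ → |tubeFun α ε N (I.H x y) η - tubeFun α ε N (I.H x' y') ξ| ≤
      lipConst S α ε δ / N * dist η ξ := by
    intro hd
    refine (abs_profile_sub_profile_le_one hα _ _).trans ?_
    have hC : 0 < IConst α * (1 - 2 * ε) := mul_pos (IConst_pos hα.le) (by linarith)
    have h3 : 1 / δ ≤ lipConst S α ε δ := le_add_of_nonneg_left (by positivity)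
    calc (1 : ℝ) = 1 / δ / N * (δ * N) := by field_simp
      _ ≤ lipConst S α ε δ / N * dist η ξ := by
        have := lipConst_nonneg (S := S) hα hε hδ
        gcongr
  by_cases hηx : 2 * δ * N ≤ η x
  · exact hfar (le_dist_of_le_sub x (by linarith [hξT x h1 h2]))
  · push Not at hηx
    have hcl : ∑ z, (clearOn {x, y} η z : ℝ) ≤ Fintype.card S * (δ * N) := by
      have : ∀ z ∈ Finset.univ, (clearOn {x, y} η z : ℝ) ≤ δ * N := by
        intro z _
        by_cases hz : z ∈ ({x, y} : Finset S)
        · simp only [clearOn, hz, if_true]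
          push_cast
          positivity
        · simp only [clearOn, hz, if_false]
          simp only [Finset.mem_insert, Finset.mem_singleton, not_or] at hz
          exact hηT z hz.1 hz.2
      simpa using Finset.sum_le_card_nsmul _ _ _ this
    have hsum : (N : ℝ) = ∑ z, (clearOn {x, y} η z : ℝ) + ((η x : ℝ) + η y) := by
      have := sum_clearOn {x, y} η
      rw [mem_configs.1 hη, Finset.sum_pair hxy] at this
      exact_mod_cast this
    have hεN : (Fintype.card S + 2) * δ * N ≤ ε * N := by gcongr
    have hηy : (1 - ε) * N ≤ η y := by linarith
    have hv : tubeFun α ε N (I.H x y) η = I.c y := by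
      rw [I.symm]
      exact I.tubeFun_near hα hε hN hy hx hη hηy
    by_cases hyx' : y = x'
    · subst hyx'
      rw [hv, ← I.tubeFun_near hα hε hN hx' hy' hη hηy]
      exact I.abs_tubeFun_sub_tubeFun_le hα hε hN hδ _ _ _ _
    · by_cases hyy' : y = y'
      · subst hyy'
        rw [hv, I.symm x' y, ← I.tubeFun_near hα hε hN hy' hx' hη hηy]
        exact I.abs_tubeFun_sub_tubeFun_le hα hε hN hδ _ _ _ _
      · refine hfar (le_dist_of_le_sub y ?_)
        have h3 := hξT y hyx' hyy'
        have h4 : 0 ≤ Fintype.card S * (δ * (N : ℝ)) := by positivity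
        have h5 : ε * N ≤ 1 / 4 * N := by gcongr
        linarith

theorem exists_testFun (hα : 0 < α) (hε : ε ≤ 1 / 4) (hN : 0 < N) {δ : ℝ} (hδ : 0 < δ)
    (hδε : (Fintype.card S + 2) * δ ≤ ε) :
    ∃ F : (S → ℕ) → ℝ, (∀ x ∈ A, ∀ y ∈ A, x ≠ y → ∀ η ∈ configs S N,
      (∀ z, z ≠ x → z ≠ y → (η z : ℝ) ≤ δ * N) → F η = tubeFun α ε N (I.H x y) η) ∧
      ∀ η ξ, |F η - F ξ| ≤ lipConst S α ε δ / N * dist η ξ := by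
  let T := {q : (S × S) × (S → ℕ) // q.1.1 ∈ A ∧ q.1.2 ∈ A ∧ q.1.1 ≠ q.1.2 ∧ q.2 ∈ configs S N ∧
    ∀ z, z ≠ q.1.1 → z ≠ q.1.2 → (q.2 z : ℝ) ≤ δ * N}
  have hT : ∀ p q : T, |tubeFun α ε N (I.H p.1.1.1 p.1.1.2) p.1.2 -
      tubeFun α ε N (I.H q.1.1.1 q.1.1.2) q.1.2| ≤
        lipConst S α ε δ / N * dist p.1.2 q.1.2 := by
    rintro ⟨⟨⟨x, y⟩, η⟩, hx, hy, hxy, hη, hT⟩ ⟨⟨⟨x', y'⟩, ξ⟩, hx', hy', hxy', hξ, hT'⟩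
    dsimp only at *
    -- Either the two tubes have the same pair of endpoints, or some endpoint of the first is not
    -- one of the second.
    by_cases h1 : x = x' ∨ x = y'
    · by_cases h2 : y = x' ∨ y = y'
      · have h3 : I.H x y = I.H x' y' := by
          rcases h1 with rfl | rfl
          · rcases h2 with rfl | rfl
            · exact absurd rfl hxy
            · rfl
          · rcases h2 with rfl | rfl
            · exact I.symm _ _
            · exact absurd rfl hxy
        rw [h3]
        exact I.abs_tubeFun_sub_tubeFun_le hα hε hN hδ _ _ _ _
      · push Not at h2
        rw [I.symm x y]
        exact I.abs_tubeFun_sub_tubeFun_le_of_not_mem hα hε hN hδ hδε hy hx hx' hy' hxy.symm hη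
          (fun z hz1 hz2 => hT z hz2 hz1) hT' h2.1 h2.2
    · push Not at h1
      exact I.abs_tubeFun_sub_tubeFun_le_of_not_mem hα hε hN hδ hδε hx hy hx' hy' hxy hη hT hT'
        h1.1 h1.2
  obtain ⟨F, hF, hL⟩ := exists_lipschitz_extension (fun q : T => q.1.2) _
    (div_nonneg (lipConst_nonneg hα hε hδ) (by positivity)) hT
  exact ⟨F, fun x hx y hy hxy η hη hT => hF ⟨((x, y), η), hx, hy, hxy, hη, hT⟩, hL⟩

end Interpolation

end testFun

/-! ### Upper bound for the Dirichlet form of the test function -/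

section upper

variable {S : Type*} [Fintype S] [DecidableEq S] {α ε δ : ℝ} {r : S → S → ℝ} {m : S → ℝ} {n K : ℕ}

/-- `F` coincides with the tube functions on the tubes joining the sites of `A` and is Lipschitz. -/
structure IsTestFun {A : Finset S} (I : Interpolation A) (α ε δ : ℝ) (N : ℕ)
    (F : (S → ℕ) → ℝ) : Prop where
  eq_tubeFun : ∀ x ∈ A, ∀ y ∈ A, x ≠ y → ∀ η ∈ configs S N,
    (∀ z, z ≠ x → z ≠ y → (η z : ℝ) ≤ δ * N) → F η = tubeFun α ε N (I.H x y) η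
  lipschitz : ∀ η ξ, |F η - F ξ| ≤ Interpolation.lipConst S α ε δ / N * dist η ξ

theorem configs_inj_of_clearOn_pair {x y : S} (hxy : x ≠ y) {ξ η : S → ℕ}
    (hξ : ξ ∈ configs S n) (hη : η ∈ configs S n) (h : clearOn {x, y} ξ = clearOn {x, y} η)
    (hx : ξ x = η x) : ξ = η := by
  have h1 := sum_clearOn {x, y} ξ
  have h2 := sum_clearOn {x, y} η
  rw [mem_configs.1 hξ, Finset.sum_pair hxy, h] at h1
  rw [mem_configs.1 hη, Finset.sum_pair hxy] at h2
  refine eq_of_clearOn_eq h fun z hz => ?_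
  rcases Finset.mem_insert.1 hz with rfl | hz
  · exact hx
  · rw [Finset.mem_singleton] at hz
    subst hz
    omega

namespace IsTestFun

variable {A : Finset S} {I : Interpolation A} {F : (S → ℕ) → ℝ}

/-- All other sites hold at most `δN`, so `η` lies in the tube from `x` to any other site of `A`. A
second site in `A` is needed for such a tube to exist. -/
theorem eq_of_near {N : ℕ} (hF : IsTestFun I α ε δ N F) (hα : 0 < α) (hε : ε ≤ 1 / 4) (hN : 0 < N)
    (hδε : δ ≤ ε) (hA : 2 ≤ A.card) {x : S} (hx : x ∈ A) {η : S → ℕ}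
    (hη : η ∈ configs S N) (h : (1 - δ) * N ≤ η x) : F η = I.c x := by
  have hN' : 0 < (N : ℝ) := by exact_mod_cast hN
  obtain ⟨y, hy, hyx⟩ := Finset.exists_mem_ne hA x
  rw [hF.eq_tubeFun x hx y hy hyx.symm η hη, I.tubeFun_near hα hε hN hx hy hη]
  · refine le_trans ?_ h
    gcongr
  · intro z hzx _
    have h1 := Finset.add_sum_erase Finset.univ η (Finset.mem_univ x)
    rw [mem_configs.1 hη] at h1
    have h2 := Finset.single_le_sum (f := η) (fun _ _ => Nat.zero_le _)
      (Finset.mem_erase.2 ⟨hzx, Finset.mem_univ z⟩)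
    have h3 : (η x : ℝ) + η z ≤ N := by exact_mod_cast (by omega : η x + η z ≤ N)
    linarith

variable (hF : IsTestFun I α ε δ (n + 1) F)

include hF

theorem walkDirichlet_le (hr : ∀ x y, 0 ≤ r x y) (hm : ∀ x, 0 ≤ m x) (hα : 0 < α)
    (hε : ε ≤ 1 / 4) (hδ : 0 < δ) (ξ : S → ℕ) :
    walkDirichlet r m (fun z => F (addOne ξ z)) ≤
      (Interpolation.lipConst S α ε δ / ((n + 1 : ℕ) : ℝ)) ^ 2 *
        (1 / 2 * ∑ x, ∑ y, m x * r x y) := by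
  rw [walkDirichlet, mul_left_comm]
  refine mul_le_mul_of_nonneg_left ?_ (by norm_num)
  rw [Finset.mul_sum]
  refine Finset.sum_le_sum fun x _ => ?_
  rw [Finset.mul_sum]
  refine Finset.sum_le_sum fun y _ => ?_
  rw [mul_comm]
  refine mul_le_mul_of_nonneg_right ?_ (mul_nonneg (hm x) (hr x y))
  rw [← sq_abs]
  refine pow_le_pow_left₀ (abs_nonneg _) ((hF.lipschitz _ _).trans ?_) 2
  exact mul_le_of_le_one_right
    (div_nonneg (Interpolation.lipConst_nonneg hα hε hδ) (by positivity)) (dist_addOne_le ξ y x)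

theorem walkDirichlet_eq_zero_of_near (hα : 0 < α) (hε : ε ≤ 1 / 4) (hδε : δ ≤ ε)
    (hA : 2 ≤ A.card) {x : S} (hx : x ∈ A) {ξ : S → ℕ}
    (hξ : ξ ∈ configs S n) (h : (1 - δ) * ((n + 1 : ℕ) : ℝ) ≤ ξ x) :
    walkDirichlet r m (fun z => F (addOne ξ z)) = 0 := by
  have : ∀ z, F (addOne ξ z) = I.c x := fun z =>
    hF.eq_of_near hα hε n.succ_pos hδε hA hx (addOne_mem hξ z)
      (h.trans (by exact_mod_cast le_addOne ξ z x))
  simp [walkDirichlet, this]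

theorem eq_of_mem_tube {x y : S} (hx : x ∈ A) (hy : y ∈ A) (hxy : x ≠ y) {ξ : S → ℕ}
    (hξ : ξ ∈ configs S n) (hK : (K : ℝ) + 1 ≤ δ * ((n + 1 : ℕ) : ℝ))
    (hbox : clearOn {x, y} ξ ∈ box {x, y} K) (z : S) :
    F (addOne ξ z) = tubeFun α ε (n + 1) (I.H x y) (addOne ξ z) := by
  refine hF.eq_tubeFun x hx y hy hxy _ (addOne_mem hξ z) fun w hwx hwy => ?_
  have h1 := clearOn_mem_box.1 hbox w (by simp [hwx, hwy])
  have h2 := addOne_le ξ z w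
  have h3 : (addOne ξ z w : ℝ) ≤ K + 1 := by exact_mod_cast h2.trans (by omega)
  exact h3.trans hK

theorem walkDirichlet_eq_zero_of_mem_tube {x y : S} (hx : x ∈ A) (hy : y ∈ A) (hxy : x ≠ y)
    {ξ : S → ℕ} (hξ : ξ ∈ configs S n) (hK : (K : ℝ) + 1 ≤ δ * ((n + 1 : ℕ) : ℝ))
    (hbox : clearOn {x, y} ξ ∈ box {x, y} K) (hc : I.c x = I.c y) :
    walkDirichlet r m (fun z => F (addOne ξ z)) = 0 := by
  have : ∀ z, F (addOne ξ z) = profile α ε (I.c x) := by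
    intro z
    have h1 : ∑ w, (addOne ξ z w : ℝ) = ((n + 1 : ℕ) : ℝ) := by
      exact_mod_cast mem_configs.1 (addOne_mem hξ z)
    rw [hF.eq_of_mem_tube hx hy hxy hξ hK hbox z, tubeFun]
    simp only [I.const x hx y hy hc]
    rw [← Finset.mul_sum, h1, mul_div_cancel_right₀ _ (by positivity)]
  simp [walkDirichlet, this]

/-- In the tube, `F(ξ + e_z) = φ((s + h(z))/N)` with `s` between `ξ_x` and `ξ_x` plus the
background. Increments in `z` are thus at most the slope of `φ` times those of `h/N`, and the slope
is controlled by `ξ_x^α ξ_y^α`. -/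
theorem walkDirichlet_le_of_mem_tube (hr : ∀ x y, 0 ≤ r x y) (hm : ∀ x, 0 ≤ m x) (hα : 0 < α)
    (hε : ε ≤ 1 / 4) {x y : S} (hx : x ∈ A) (hy : y ∈ A) (hxy : x ≠ y)
    {ξ : S → ℕ} (hξ : ξ ∈ configs S n) (hK : (K : ℝ) + 1 ≤ δ * ((n + 1 : ℕ) : ℝ))
    (hKε : (Fintype.card S : ℝ) * K + 1 ≤ ε * ((n + 1 : ℕ) : ℝ))
    (hbox : clearOn {x, y} ξ ∈ box {x, y} K) (hcx : I.c x = 1) (hcy : I.c y = 0) :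
    walkDirichlet r m (fun z => F (addOne ξ z)) ≤
      ((ξ x : ℝ) ^ α * (ξ y : ℝ) ^ α /
        (((n + 1 : ℕ) : ℝ) ^ (2 * α + 1) * (IConst α * (1 - 2 * ε) ^ (2 * α + 1)))) ^ 2 *
        walkDirichlet r m (I.H x y) := by
  set N : ℝ := ((n + 1 : ℕ) : ℝ) with hNdef
  have hN : 0 < N := by positivity
  set k : ℝ := ((∑ z, clearOn {x, y} ξ z : ℕ) : ℝ) with hk
  have hkK : k ≤ Fintype.card S * K := by
    rw [hk]
    exact_mod_cast sum_le_of_mem_box hbox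
  have hsum : N = k + (ξ x + ξ y) + 1 := by
    have h := sum_clearOn {x, y} ξ
    rw [mem_configs.1 hξ, Finset.sum_pair hxy] at h
    rw [hNdef, hk, h]
    push_cast
    ring
  have hHx : I.H x y x = 1 := by rw [I.left x hx y hy, hcx]
  have hHy : I.H x y y = 0 := by rw [I.right hx hy, hcy]
  set s : ℝ := ∑ w, I.H x y w * (ξ w : ℝ) with hs
  have hs1 : (ξ x : ℝ) ≤ s := by
    have := Finset.single_le_sum (f := fun w => I.H x y w * (ξ w : ℝ))
      (fun w _ => mul_nonneg (I.nonneg x y w) (by positivity)) (Finset.mem_univ x)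
    simpa [hHx] using this
  have hs2 : s ≤ ξ x + k := by
    have h1 : ∀ w ∈ Finset.univ, I.H x y w * (ξ w : ℝ) ≤
        (clearOn {x, y} ξ w : ℝ) + if w = x then (ξ x : ℝ) else 0 := by
      intro w _
      by_cases hwx : w = x
      · subst hwx
        simp [hHx, clearOn]
      · by_cases hwy : w = y
        · subst hwy
          simp [hHy, clearOn, hwx]
        · simp only [clearOn, Finset.mem_insert, Finset.mem_singleton, hwx, hwy, or_self, if_false,
            add_zero]
          exact mul_le_of_le_one_left (by positivity) (I.le_one x y w)
    have h2 := Finset.sum_le_sum h1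
    rw [Finset.sum_add_distrib, Finset.sum_ite_eq' Finset.univ x] at h2
    simp only [Finset.mem_univ, if_true] at h2
    rw [hk]
    push_cast
    linarith
  refine walkDirichlet_le_of_abs_le hr hm fun u v => ?_
  rw [hF.eq_of_mem_tube hx hy hxy hξ hK hbox u, hF.eq_of_mem_tube hx hy hxy hξ hK hbox v, tubeFun,
    tubeFun, sum_addOne_mul, sum_addOne_mul, ← hs, ← hNdef]
  have hup : ∀ z, (s + I.H x y z) / N ≤ ξ x / N + ε := by
    intro z
    rw [div_add' _ _ _ hN.ne', div_le_div_iff_of_pos_right hN]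
    linarith [I.le_one x y z]
  have hlo : ∀ z, 1 - ε ≤ (s + I.H x y z) / N + ξ y / N := by
    intro z
    rw [← add_div, le_div_iff₀ hN]
    linarith [I.nonneg x y z]
  refine (abs_profile_sub_le_of_le hα hε (by positivity) (by positivity) (hup v) (hup u) (hlo v)
    (hlo u)).trans (le_of_eq ?_)
  rw [← sub_div, add_sub_add_left_eq_sub, abs_div, abs_of_pos hN, Real.div_rpow (by positivity) hN.le,
    Real.div_rpow (by positivity) hN.le, Real.rpow_add hN, two_mul α, Real.rpow_add hN,
    Real.rpow_one]
  have := Real.rpow_pos_of_pos hN α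
  have := IConst_pos hα.le
  field_simp

/-- The squared slope carries `(a(ξ_x) a(ξ_y))²` and the weight carries its inverse to the first
power. One factor `a(ξ_x) a(ξ_y)` survives, and it sums to `convSum`. -/
theorem sum_tube_le (hr : ∀ x y, 0 ≤ r x y) (hm : ∀ x, 0 ≤ m x) (hM : 0 < maxMass m) (hα : 0 < α)
    (hε : ε ≤ 1 / 4) (hA : A ⊆ maxSites m) {x y : S} (hx : x ∈ A) (hy : y ∈ A) (hxy : x ≠ y)
    (hK : (K : ℝ) + 1 ≤ δ * ((n + 1 : ℕ) : ℝ))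
    (hKε : (Fintype.card S : ℝ) * K + 1 ≤ ε * ((n + 1 : ℕ) : ℝ))
    (hcx : I.c x = 1) (hcy : I.c y = 0) :
    ∑ ξ ∈ configs S n with clearOn {x, y} ξ ∈ box {x, y} K,
      weight α m ξ * walkDirichlet r m (fun z => F (addOne ξ z)) ≤
      walkDirichlet r m (I.H x y) * (∏ z ∈ Finset.univ \ {x, y}, partGamma α m K z) *
        (convSum α n / (((n + 1 : ℕ) : ℝ) ^ (2 * α + 1) *
          (IConst α * (1 - 2 * ε) ^ (2 * α + 1))) ^ 2) := by
  set B : ℝ := ((n + 1 : ℕ) : ℝ) ^ (2 * α + 1) * (IConst α * (1 - 2 * ε) ^ (2 * α + 1)) with hB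
  set D := walkDirichlet r m (I.H x y) with hD
  have hD0 : 0 ≤ D := walkDirichlet_nonneg hr hm _
  have hw := weight_nonneg (α := α) hm
  have h1 : ∑ ξ ∈ configs S n with clearOn {x, y} ξ ∈ box {x, y} K,
      weight α m ξ * walkDirichlet r m (fun z => F (addOne ξ z)) ≤
      ∑ q ∈ box {x, y} K ×ˢ Finset.range (n + 1),
        weight α m q.1 * (aFun α q.2 * aFun α (n - q.2)) * (D / B ^ 2) := by
    refine sum_le_sum_of_injOn (fun ξ => (clearOn {x, y} ξ, ξ x)) ?_ ?_ ?_ ?_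
    · intro ξ hξ η hη h
      rw [Prod.mk.injEq] at h
      exact configs_inj_of_clearOn_pair hxy (Finset.mem_filter.1 hξ).1 (Finset.mem_filter.1 hη).1
        h.1 h.2
    · intro ξ hξ
      obtain ⟨h1, h2⟩ := Finset.mem_filter.1 hξ
      have := le_of_mem_configs h1 x
      exact Finset.mem_product.2 ⟨h2, Finset.mem_range.2 (by dsimp only; omega)⟩
    · intro ξ hξ
      obtain ⟨h1, h2⟩ := Finset.mem_filter.1 hξ
      have hle := hF.walkDirichlet_le_of_mem_tube hr hm hα hε hx hy hxy h1 hK hKε h2 hcx hcy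
      rw [← hB, ← hD] at hle
      refine (mul_le_mul_of_nonneg_left hle (hw ξ)).trans ?_
      rw [weight_eq_clearOn_pair hM hxy (hA hx) (hA hy) ξ]
      dsimp only
      have hi := rpow_le_aFun hα (ξ x)
      have hj := rpow_le_aFun hα (ξ y)
      have hi0 := aFun_pos (α := α) (ξ x)
      have hj0 := aFun_pos (α := α) (ξ y)
      -- Ignoring the background in the count at `y` decouples the sum over `ξ_x` from the sum over
      -- backgrounds.
      have hjn : aFun α (ξ y) ≤ aFun α (n - ξ x) := by
        refine aFun_mono hα.le ?_
        have h := sum_clearOn {x, y} ξ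
        rw [mem_configs.1 h1, Finset.sum_pair hxy] at h
        omega
      have h3 : ((ξ x : ℝ) ^ α * (ξ y : ℝ) ^ α) ^ 2 ≤ (aFun α (ξ x) * aFun α (ξ y)) ^ 2 := by
        gcongr
      calc weight α m (clearOn {x, y} ξ) / (aFun α (ξ x) * aFun α (ξ y)) *
            (((ξ x : ℝ) ^ α * (ξ y : ℝ) ^ α / B) ^ 2 * D)
          = weight α m (clearOn {x, y} ξ) / (aFun α (ξ x) * aFun α (ξ y)) *
            ((ξ x : ℝ) ^ α * (ξ y : ℝ) ^ α) ^ 2 * (D / B ^ 2) := by ring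
        _ ≤ weight α m (clearOn {x, y} ξ) / (aFun α (ξ x) * aFun α (ξ y)) *
            (aFun α (ξ x) * aFun α (ξ y)) ^ 2 * (D / B ^ 2) := by
            have := hw (clearOn {x, y} ξ)
            gcongr
        _ = weight α m (clearOn {x, y} ξ) * (aFun α (ξ x) * aFun α (ξ y)) * (D / B ^ 2) := by
            field_simp
        _ ≤ _ := by
            have := hw (clearOn {x, y} ξ)
            gcongr
    · intro q _
      exact mul_nonneg (mul_nonneg (hw _) (mul_pos (aFun_pos _) (aFun_pos _)).le)
        (div_nonneg hD0 (sq_nonneg _))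
  refine h1.trans (le_of_eq ?_)
  rw [← Finset.sum_mul, Finset.sum_product]
  dsimp only
  rw [← sum_box_weight, ← Finset.sum_mul_sum, ← convSum]
  ring

end IsTestFun

/-- Two large sites cost `(δN)^(-2α)`, there are at most `n + 1` values of `ξ_x`, and the background
lies outside the box. After multiplication by `N^(2α+1) N^(-2)` this is of order one in `N`; its
smallness comes only from `boxTail` as `K → ∞`. -/
theorem sum_two_sites_le (hm : ∀ x, 0 ≤ m x) (hM : 0 < maxMass m) (hα : 1 < α) {x y : S}
    (hx : x ∈ maxSites m) (hy : y ∈ maxSites m) (hxy : x ≠ y) (hδ : 0 < δ) (hKn : K ≤ n) :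
    ∑ ξ ∈ configs S n with (δ * ((n + 1 : ℕ) : ℝ) ≤ ξ x ∧ δ * ((n + 1 : ℕ) : ℝ) ≤ ξ y) ∧
        clearOn {x, y} ξ ∉ box {x, y} K, weight α m ξ ≤
      ((n + 1 : ℕ) : ℝ) / (δ * ((n + 1 : ℕ) : ℝ)) ^ (2 * α) * boxTail α m {x, y} K := by
  set N : ℝ := ((n + 1 : ℕ) : ℝ) with hNdef
  have hN : 0 < N := by positivity
  have hw := weight_nonneg (α := α) hm
  have h1 : ∑ ξ ∈ configs S n with (δ * N ≤ ξ x ∧ δ * N ≤ ξ y) ∧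
        clearOn {x, y} ξ ∉ box {x, y} K, weight α m ξ ≤
      ∑ q ∈ (box {x, y} n \ box {x, y} K) ×ˢ Finset.range (n + 1),
        weight α m q.1 * (1 / (δ * N) ^ (2 * α)) := by
    refine sum_le_sum_of_injOn (fun ξ => (clearOn {x, y} ξ, ξ x)) ?_ ?_ ?_ ?_
    · intro ξ hξ η hη h
      rw [Prod.mk.injEq] at h
      exact configs_inj_of_clearOn_pair hxy (Finset.mem_filter.1 hξ).1 (Finset.mem_filter.1 hη).1
        h.1 h.2
    · intro ξ hξ
      obtain ⟨h1, -, h2⟩ := Finset.mem_filter.1 hξ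
      have := le_of_mem_configs h1 x
      exact Finset.mem_product.2 ⟨Finset.mem_sdiff.2 ⟨clearOn_mem_box_of_configs h1, h2⟩,
        Finset.mem_range.2 (by dsimp only; omega)⟩
    · intro ξ hξ
      obtain ⟨-, ⟨h2, h3⟩, -⟩ := Finset.mem_filter.1 hξ
      rw [weight_eq_clearOn_pair hM hxy hx hy ξ, ← mul_one_div]
      refine mul_le_mul_of_nonneg_left ?_ (hw _)
      have hα0 : 0 < α := by linarith
      have hp : 0 < (δ * N) ^ α := by positivity
      rw [two_mul, Real.rpow_add (by positivity)]
      refine one_div_le_one_div_of_le (by positivity) ?_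
      exact mul_le_mul ((Real.rpow_le_rpow (by positivity) h2 hα0.le).trans (rpow_le_aFun hα0 _))
        ((Real.rpow_le_rpow (by positivity) h3 hα0.le).trans (rpow_le_aFun hα0 _)) hp.le
        (aFun_pos _).le
    · intro q _
      exact mul_nonneg (hw _) (by positivity)
  refine h1.trans ?_
  rw [← Finset.sum_mul, Finset.sum_product]
  simp only [Finset.sum_const, Finset.card_range, nsmul_eq_mul]
  rw [← Finset.mul_sum, ← hNdef]
  have h2 := sum_box_sdiff_le hα hm {x, y} hKn
  calc N * (∑ ζ ∈ box {x, y} n \ box {x, y} K, weight α m ζ) * (1 / (δ * N) ^ (2 * α))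
      ≤ N * boxTail α m {x, y} K * (1 / (δ * N) ^ (2 * α)) := by
        gcongr
    _ = _ := by ring

end upper

/-! ### Near-optimal interpolations -/

section interpolation

variable {S : Type*} [Fintype S] [DecidableEq S] {α : ℝ} {r : S → S → ℝ} {m : S → ℝ}

/-- Truncating a near-minimizer to `[0,1]` does not increase its Dirichlet form. -/
theorem exists_walkDirichlet_le (hr : ∀ x y, 0 ≤ r x y) (hm : ∀ x, 0 ≤ m x) {x y : S}
    (hxy : x ≠ y) {t : ℝ} (ht : 0 < t) :
    ∃ h : S → ℝ, h x = 1 ∧ h y = 0 ∧ (∀ z, 0 ≤ h z) ∧ (∀ z, h z ≤ 1) ∧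
      walkDirichlet r m h ≤ walkCap r m x y + t := by
  have hne : (walkDirichlet r m '' {f : S → ℝ | f x = 1 ∧ f y = 0}).Nonempty :=
    ⟨_, Pi.single x 1, ⟨by simp, by simp [hxy.symm]⟩, rfl⟩
  obtain ⟨_, ⟨f, ⟨hfx, hfy⟩, rfl⟩, hf⟩ :=
    exists_lt_of_csInf_lt hne (lt_add_of_pos_right (walkCap r m x y) ht)
  refine ⟨fun z => max 0 (min 1 (f z)), by simp [hfx], by simp [hfy], fun z => le_max_left _ _,
    fun z => max_le zero_le_one (min_le_left _ _), ?_⟩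
  have hclamp : ∀ a b : ℝ, |max 0 (min 1 a) - max 0 (min 1 b)| ≤ |a - b| := fun a b =>
    calc |max 0 (min 1 a) - max 0 (min 1 b)| ≤ max |(0 : ℝ) - 0| |min 1 a - min 1 b| :=
          abs_max_sub_max_le_max _ _ _ _
      _ ≤ max |(0 : ℝ) - 0| (max |(1 : ℝ) - 1| |a - b|) :=
          max_le_max le_rfl (abs_min_sub_min_le_max _ _ _ _)
      _ = |a - b| := by simp
  have := walkDirichlet_le_of_abs_le hr hm (f := fun z => max 0 (min 1 (f z))) (g := f) (c := 1)
    fun u v => by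
      rw [one_mul]
      exact hclamp _ _
  rw [one_pow, one_mul] at this
  linarith

theorem exists_interpolation (hr : ∀ x y, 0 ≤ r x y) (hm : ∀ x, 0 ≤ m x) (A S₁ : Finset S)
    {t : ℝ} (ht : 0 < t) : ∃ I : Interpolation A, (∀ x, I.c x = if x ∈ S₁ then 1 else 0) ∧
      ∀ x ∈ S₁, ∀ y ∉ S₁, walkDirichlet r m (I.H x y) ≤ walkCap r m x y + t := by
  have hex : ∀ p : S × S, ∃ h : S → ℝ, p.1 ≠ p.2 → h p.1 = 1 ∧ h p.2 = 0 ∧ (∀ z, 0 ≤ h z) ∧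
      (∀ z, h z ≤ 1) ∧ walkDirichlet r m h ≤ walkCap r m p.1 p.2 + t := by
    intro p
    by_cases hp : p.1 = p.2
    · exact ⟨0, fun h => absurd hp h⟩
    · obtain ⟨h, hh⟩ := exists_walkDirichlet_le hr hm hp ht
      exact ⟨h, fun _ => hh⟩
  choose h hh using hex
  have hS : ∀ {x y : S}, x ∈ S₁ → y ∉ S₁ → x ≠ y := fun hx hy hxy => hy (hxy ▸ hx)
  let H : S → S → S → ℝ := fun x y =>
    if x ∈ S₁ then if y ∈ S₁ then fun _ => 1 else h (x, y)
    else if y ∈ S₁ then h (y, x) else fun _ => 0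
  refine ⟨⟨fun x => if x ∈ S₁ then 1 else 0, H, ?_, ?_, ?_, ?_, ?_, ?_⟩, fun x => rfl, ?_⟩
  · intro x
    by_cases hx : x ∈ S₁ <;> simp [hx]
  · intro x y
    by_cases hx : x ∈ S₁ <;> by_cases hy : y ∈ S₁ <;> simp [H, hx, hy]
  · intro x y z
    by_cases hx : x ∈ S₁ <;> by_cases hy : y ∈ S₁ <;> simp only [H, hx, hy, if_true, if_false]
    · exact zero_le_one
    · exact (hh (x, y) (hS hx hy)).2.2.1 z
    · exact (hh (y, x) (hS hy hx)).2.2.1 z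
    · exact le_rfl
  · intro x y z
    by_cases hx : x ∈ S₁ <;> by_cases hy : y ∈ S₁ <;> simp only [H, hx, hy, if_true, if_false]
    · exact le_rfl
    · exact (hh (x, y) (hS hx hy)).2.2.2.1 z
    · exact (hh (y, x) (hS hy hx)).2.2.2.1 z
    · exact zero_le_one
  · intro x _ y _
    by_cases hx : x ∈ S₁ <;> by_cases hy : y ∈ S₁ <;> simp only [H, hx, hy, if_true, if_false]
    · exact (hh (x, y) (hS hx hy)).1
    · exact (hh (y, x) (hS hy hx)).2.1
  · intro x _ y _ hc z
    by_cases hx : x ∈ S₁ <;> by_cases hy : y ∈ S₁ <;> simp_all [H]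
  · intro x hx y hy
    simp only [H, hx, hy, if_true, if_false]
    exact (hh (x, y) (hS hx hy)).2.2.2.2

end interpolation

/-! ### The Dirichlet form of the test function -/

section bound

variable {S : Type*} [Fintype S] [DecidableEq S] {α ε δ : ℝ} {r : S → S → ℝ} {m : S → ℝ} {n K : ℕ}

/-- Pigeonhole twice. The fullest site is large, hence in `A`. If all others stayed below
`δN/(2|S|)`, together they would hold at most `δN/2`, and as `δN > 2` the fullest site would hold at
least `(1-δ)N`. -/
theorem exists_two_large_sites [Nonempty S] (hδ : 0 < δ) (hδ1 : δ ≤ 1) {A : Finset S} {ξ : S → ℕ}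
    (hξ : ξ ∈ configs S n) (hn : 2 < δ * ((n + 1 : ℕ) : ℝ))
    (hout : ∀ z ∉ A, (ξ z : ℝ) < δ / (2 * Fintype.card S) * ((n + 1 : ℕ) : ℝ))
    (hnear : ∀ x ∈ A, (ξ x : ℝ) < (1 - δ) * ((n + 1 : ℕ) : ℝ)) :
    ∃ x ∈ A, ∃ y ∈ A, x ≠ y ∧ δ / (2 * Fintype.card S) * ((n + 1 : ℕ) : ℝ) ≤ ξ x ∧
      δ / (2 * Fintype.card S) * ((n + 1 : ℕ) : ℝ) ≤ ξ y := by
  have hd : 0 < (Fintype.card S : ℝ) := by exact_mod_cast Fintype.card_pos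
  set N : ℝ := ((n + 1 : ℕ) : ℝ) with hNdef
  have hNn : N = n + 1 := by rw [hNdef]; push_cast; ring
  have hN : 0 < N := by positivity
  set κ : ℝ := δ / (2 * Fintype.card S) with hκ
  have hκd : Fintype.card S * (κ * N) = δ * N / 2 := by
    rw [hκ]
    field_simp
  have hδN : δ * N ≤ N := mul_le_of_le_one_left hN.le hδ1
  obtain ⟨x, hx⟩ := exists_card_mul_ge hξ
  have hx' : (n : ℝ) ≤ Fintype.card S * ξ x := by exact_mod_cast hx
  have hxκ : κ * N ≤ ξ x := by
    rw [← mul_le_mul_iff_of_pos_left hd, hκd]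
    linarith
  have hxA : x ∈ A := by
    by_contra h
    exact absurd hxκ (not_le.2 (hout x h))
  have hy : ∃ y, x ≠ y ∧ κ * N ≤ ξ y := by
    by_contra! h
    have h1 : ∀ z ∈ Finset.univ, (clearOn {x} ξ z : ℝ) ≤ κ * N := by
      intro z _
      by_cases hz : z = x
      · simp only [clearOn, hz, Finset.mem_singleton, if_true]
        push_cast
        positivity
      · simp only [clearOn, hz, Finset.mem_singleton, if_false]
        exact (h z (Ne.symm hz)).le
    have h2 := Finset.sum_le_card_nsmul _ _ _ h1
    rw [nsmul_eq_mul, Finset.card_univ, hκd] at h2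
    have h3 := sum_clearOn {x} ξ
    rw [mem_configs.1 hξ, Finset.sum_singleton] at h3
    have h4 : (n : ℝ) = ∑ z, (clearOn {x} ξ z : ℝ) + ξ x := by exact_mod_cast h3
    have := hnear x hxA
    linarith
  obtain ⟨y, hxy, hyκ⟩ := hy
  refine ⟨x, hxA, y, ?_, hxy, hxκ, hyκ⟩
  by_contra h
  exact absurd hyκ (not_le.2 (hout y h))

open Classical in
theorem IsTestFun.sum_weight_mul_walkDirichlet_le [Nonempty S] {I : Interpolation (maxSites m)}
    {F : (S → ℕ) → ℝ} (hF : IsTestFun I α ε δ (n + 1) F) (hr : ∀ x y, 0 ≤ r x y)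
    (hm : ∀ x, 0 ≤ m x) (hM : 0 < maxMass m) (hα : 1 < α) (hε : ε ≤ 1 / 4) (hδ : 0 < δ)
    (hδε : δ ≤ ε) (hκ : 2 ≤ (maxSites m).card) {S₁ : Finset S} (hS₁ : S₁ ⊆ maxSites m)
    (hc : ∀ x, I.c x = if x ∈ S₁ then 1 else 0)
    (hK : (K : ℝ) + 1 ≤ δ * ((n + 1 : ℕ) : ℝ))
    (hKε : (Fintype.card S : ℝ) * K + 1 ≤ ε * ((n + 1 : ℕ) : ℝ))
    (hn : 2 < δ * ((n + 1 : ℕ) : ℝ)) :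
    ∑ ξ ∈ configs S n, weight α m ξ * walkDirichlet r m (fun z => F (addOne ξ z)) ≤
      ∑ p ∈ S₁ ×ˢ (maxSites m \ S₁), walkDirichlet r m (I.H p.1 p.2) *
        (∏ z ∈ Finset.univ \ {p.1, p.2}, partGamma α m K z) *
        (convSum α n / (((n + 1 : ℕ) : ℝ) ^ (2 * α + 1) *
          (IConst α * (1 - 2 * ε) ^ (2 * α + 1))) ^ 2) +
      (Interpolation.lipConst S α ε δ / ((n + 1 : ℕ) : ℝ)) ^ 2 *
        (1 / 2 * ∑ x, ∑ y, m x * r x y) *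
        (∑ p ∈ (maxSites m).offDiag, ((n + 1 : ℕ) : ℝ) /
            (δ / (2 * Fintype.card S) * ((n + 1 : ℕ) : ℝ)) ^ (2 * α) * boxTail α m {p.1, p.2} K +
          ∑ ξ ∈ configs S n with ∃ z ∉ maxSites m,
            δ / (2 * Fintype.card S) * ((n + 1 : ℕ) : ℝ) ≤ ξ z, weight α m ξ) := by
  set N : ℝ := ((n + 1 : ℕ) : ℝ) with hNdef
  have hd : 0 < (Fintype.card S : ℝ) := by exact_mod_cast Fintype.card_pos
  have hα0 : 0 < α := by linarith
  have hδ' : 0 < δ / (2 * Fintype.card S) := by positivity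
  have hw := weight_nonneg (α := α) hm
  let G : (S → ℕ) → ℝ := fun ξ => weight α m ξ * walkDirichlet r m (fun z => F (addOne ξ z))
  have hG : ∀ ξ, 0 ≤ G ξ := fun ξ => mul_nonneg (hw ξ) (walkDirichlet_nonneg hr hm _)
  set C := (Interpolation.lipConst S α ε δ / N) ^ 2 * (1 / 2 * ∑ x, ∑ y, m x * r x y) with hC
  have hC0 : 0 ≤ C := mul_nonneg (sq_nonneg _) (mul_nonneg (by norm_num)
    (Finset.sum_nonneg fun x _ => Finset.sum_nonneg fun y _ => mul_nonneg (hm x) (hr x y)))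
  have hGC : ∀ T : Finset (S → ℕ), ∑ ξ ∈ T, G ξ ≤ C * ∑ ξ ∈ T, weight α m ξ := by
    intro T
    rw [Finset.mul_sum]
    refine Finset.sum_le_sum fun ξ _ => ?_
    rw [mul_comm C]
    exact mul_le_mul_of_nonneg_left (hF.walkDirichlet_le hr hm hα0 hε hδ ξ) (hw ξ)
  have hp : ∀ p ∈ S₁ ×ˢ (maxSites m \ S₁), p.1 ∈ S₁ ∧ p.1 ∈ maxSites m ∧ p.2 ∈ maxSites m ∧
      p.2 ∉ S₁ ∧ p.1 ≠ p.2 := by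
    intro p hp
    obtain ⟨h1, h2⟩ := Finset.mem_product.1 hp
    obtain ⟨h2, h3⟩ := Finset.mem_sdiff.1 h2
    exact ⟨h1, hS₁ h1, h2, h3, fun h => h3 (h ▸ h1)⟩
  let P1 : S × S → Finset (S → ℕ) := fun p =>
    (configs S n).filter fun ξ => clearOn {p.1, p.2} ξ ∈ box {p.1, p.2} K
  let P2 : S × S → Finset (S → ℕ) := fun p => (configs S n).filter fun ξ =>
    (δ / (2 * Fintype.card S) * N ≤ ξ p.1 ∧ δ / (2 * Fintype.card S) * N ≤ ξ p.2) ∧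
      clearOn {p.1, p.2} ξ ∉ box {p.1, p.2} K
  let P3 := (configs S n).filter fun ξ => ∃ z ∉ maxSites m, δ / (2 * Fintype.card S) * N ≤ ξ z
  -- Configurations near one site, and those in tubes whose ends carry equal boundary values,
  -- contribute zero. Only the others have to be covered.
  have hcover : (configs S n).filter (fun ξ => G ξ ≠ 0) ⊆
      (S₁ ×ˢ (maxSites m \ S₁)).biUnion P1 ∪ ((maxSites m).offDiag.biUnion P2 ∪ P3) := by
    intro ξ hξG
    obtain ⟨hξ, hG0⟩ := Finset.mem_filter.1 hξG
    have hD : walkDirichlet r m (fun z => F (addOne ξ z)) ≠ 0 := fun h => hG0 (by simp [G, h])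
    by_cases h3 : ξ ∈ P3
    · exact Finset.mem_union_right _ (Finset.mem_union_right _ h3)
    have hout : ∀ z ∉ maxSites m, (ξ z : ℝ) < δ / (2 * Fintype.card S) * N := by
      intro z hz
      by_contra h
      exact h3 (Finset.mem_filter.2 ⟨hξ, z, hz, not_lt.1 h⟩)
    have hnear : ∀ x ∈ maxSites m, (ξ x : ℝ) < (1 - δ) * N := by
      intro x hx
      by_contra h
      exact hD (hF.walkDirichlet_eq_zero_of_near hα0 hε hδε hκ hx hξ (not_lt.1 h))
    obtain ⟨x, hx, y, hy, hxy, hxκ, hyκ⟩ :=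
      exists_two_large_sites hδ (by linarith) hξ hn hout hnear
    by_cases hb : clearOn {x, y} ξ ∈ box {x, y} K
    · refine Finset.mem_union_left _ (Finset.mem_biUnion.2 ?_)
      have hcne : I.c x ≠ I.c y := fun h =>
        hD (hF.walkDirichlet_eq_zero_of_mem_tube hx hy hxy hξ hK hb h)
      rw [hc, hc] at hcne
      by_cases hx1 : x ∈ S₁ <;> by_cases hy1 : y ∈ S₁
      · simp [hx1, hy1] at hcne
      · exact ⟨(x, y), Finset.mem_product.2 ⟨hx1, Finset.mem_sdiff.2 ⟨hy, hy1⟩⟩,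
          Finset.mem_filter.2 ⟨hξ, hb⟩⟩
      · refine ⟨(y, x), Finset.mem_product.2 ⟨hy1, Finset.mem_sdiff.2 ⟨hx, hx1⟩⟩,
          Finset.mem_filter.2 ⟨hξ, ?_⟩⟩
        dsimp only
        rwa [Finset.pair_comm y x]
      · simp [hx1, hy1] at hcne
    · refine Finset.mem_union_right _ (Finset.mem_union_left _ (Finset.mem_biUnion.2 ?_))
      exact ⟨(x, y), Finset.mem_offDiag.2 ⟨hx, hy, hxy⟩,
        Finset.mem_filter.2 ⟨hξ, ⟨hxκ, hyκ⟩, hb⟩⟩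
  have hKn : K ≤ n := by
    have h1 : δ * N ≤ N := mul_le_of_le_one_left (by positivity) (by linarith)
    have h2 : ((K + 1 : ℕ) : ℝ) ≤ ((n + 1 : ℕ) : ℝ) := by
      push_cast
      rw [hNdef] at h1 hK
      push_cast at h1 hK
      linarith
    have := Nat.cast_le.1 h2
    omega
  rw [← Finset.sum_filter_ne_zero]
  refine (Finset.sum_le_sum_of_subset_of_nonneg hcover fun ξ _ _ => hG ξ).trans ?_
  refine (sum_union_le hG _ _).trans (add_le_add ((sum_biUnion_le hG _ _).trans ?_)
    ((hGC _).trans (mul_le_mul_of_nonneg_left ?_ hC0)))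
  · refine Finset.sum_le_sum fun p hpm => ?_
    obtain ⟨hp1, hx, hy, hp2, hne⟩ := hp p hpm
    exact hF.sum_tube_le hr hm hM hα0 hε subset_rfl hx hy hne hK hKε (by rw [hc, if_pos hp1])
      (by rw [hc, if_neg hp2])
  · refine (sum_union_le hw _ _).trans (add_le_add ((sum_biUnion_le hw _ _).trans ?_) le_rfl)
    refine Finset.sum_le_sum fun p hpm => ?_
    obtain ⟨hx, hy, hne⟩ := Finset.mem_offDiag.1 hpm
    exact sum_two_sites_le hm hM hα hx hy hne hδ' hKn

end bound

/-! ### Passage to the limit -/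

theorem tendsto_convSum_bound {α : ℝ} (hα : 0 < α) :
    Tendsto (fun N : ℕ => IConst α + 2 * (N : ℝ) ^ (-(α + 1))) atTop (𝓝 (IConst α)) := by
  have := ((tendsto_rpow_neg_atTop (by linarith : 0 < α + 1)).comp
    (tendsto_natCast_atTop_atTop (R := ℝ))).const_mul 2
  simpa using this.const_add (IConst α)

theorem convSum_le_mul {α : ℝ} (hα : 0 < α) (n : ℕ) :
    convSum α n ≤ ((n + 1 : ℕ) : ℝ) ^ (2 * α + 1) *
      (IConst α + 2 * ((n + 1 : ℕ) : ℝ) ^ (-(α + 1))) := by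
  refine (convSum_le hα n).trans (le_of_eq ?_)
  rw [mul_add, mul_left_comm, ← Real.rpow_add (by positivity)]
  congr 3
  ring

section limits

variable {S : Type*} [Fintype S] [DecidableEq S] {α ε δ : ℝ} {r : S → S → ℝ} {m : S → ℝ}

theorem partitionZ_nonneg (hm : ∀ x, 0 ≤ m x) (N : ℕ) : 0 ≤ partitionZ α m N :=
  mul_nonneg (by positivity) (Finset.sum_nonneg fun ξ _ => weight_nonneg hm ξ)

theorem rpow_mul_zrDirichlet (n : ℕ) (F : (S → ℕ) → ℝ) :
    ((n + 1 : ℕ) : ℝ) ^ (1 + α) * zrDirichlet α r m (n + 1) F =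
      1 / (partitionZ α m (n + 1) * maxMass m) * (((n + 1 : ℕ) : ℝ) ^ (2 * α + 1) *
        ∑ ξ ∈ configs S n, weight α m ξ * walkDirichlet r m fun z => F (addOne ξ z)) := by
  rw [zrDirichlet_eq, show 2 * α + 1 = (1 + α) + α by ring,
    Real.rpow_add (by positivity : (0 : ℝ) < ((n + 1 : ℕ) : ℝ)) (1 + α) α]
  ring

/-- The constants are chosen before `K`, so the error carrying `C₁` vanishes when `K → ∞` after `N →
∞`. -/
theorem exists_isTestFun_le [Nonempty S] (hr : ∀ x y, 0 ≤ r x y) (hm : ∀ x, 0 ≤ m x)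
    (hM : 0 < maxMass m) (hα : 1 < α) (hε : ε ≤ 1 / 4) (hδ : 0 < δ)
    (hδε : (Fintype.card S + 2) * δ ≤ ε) (hκ : 2 ≤ (maxSites m).card) {S₁ : Finset S}
    (hS₁ : S₁ ⊆ maxSites m) (I : Interpolation (maxSites m))
    (hc : ∀ x, I.c x = if x ∈ S₁ then 1 else 0) :
    ∃ C₁ C₂ s q : ℝ, 0 < q ∧ ∀ K : ℕ, ∀ᶠ N : ℕ in atTop, ∃ F, IsTestFun I α ε δ N F ∧
      (N : ℝ) ^ (1 + α) * zrDirichlet α r m N F ≤ 1 / (partitionZ α m N * maxMass m) *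
        (∑ p ∈ S₁ ×ˢ (maxSites m \ S₁), walkDirichlet r m (I.H p.1 p.2) *
          (∏ z ∈ Finset.univ \ {p.1, p.2}, partGamma α m K z) *
          ((IConst α + 2 * (N : ℝ) ^ (-(α + 1))) /
            (IConst α * (1 - 2 * ε) ^ (2 * α + 1)) ^ 2) +
        C₁ * ∑ p ∈ (maxSites m).offDiag, boxTail α m {p.1, p.2} K +
        C₂ * ((N : ℝ) ^ s * Real.exp (-q * N))) := by
  classical
  have hd : 0 < (Fintype.card S : ℝ) := by exact_mod_cast Fintype.card_pos
  have hα0 : 0 < α := by linarith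
  have hδε' : δ ≤ ε := by nlinarith
  have hε0 : 0 < ε := hδ.trans_le hδε'
  have hδ' : 0 < δ / (2 * Fintype.card S) := by positivity
  set δ' := δ / (2 * Fintype.card S) with hδ'def
  obtain ⟨q, hq, hE⟩ := exists_sum_outside_le (α := α) hα0.le hm hM hδ'
  set L := Interpolation.lipConst S α ε δ with hL
  set W := 1 / 2 * ∑ x, ∑ y, m x * r x y with hW
  have hW0 : 0 ≤ W := mul_nonneg (by norm_num)
    (Finset.sum_nonneg fun x _ => Finset.sum_nonneg fun y _ => mul_nonneg (hm x) (hr x y))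
  -- The exponent `2α - 1 + |S|` collects `N^(2α+1)` from the scaling, `N^(-2)` from the squared
  -- Lipschitz constant and `N^|S|` from the number of configurations.
  refine ⟨L ^ 2 * W / δ' ^ (2 * α), L ^ 2 * W * 2 ^ Fintype.card S,
    2 * α - 1 + Fintype.card S, q, hq, fun K => ?_⟩
  have hlarge : ∀ c : ℝ, ∀ a : ℝ, 0 < a → ∀ᶠ N : ℕ in atTop, c < a * N := fun c a ha =>
    ((tendsto_natCast_atTop_atTop (R := ℝ)).const_mul_atTop ha).eventually_gt_atTop c
  filter_upwards [hlarge 2 δ hδ, hlarge (K + 1) δ hδ, hlarge (Fintype.card S * K + 1) ε hε0,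
    eventually_gt_atTop 0] with N h2 hK hKε hN0
  obtain ⟨n, rfl⟩ := Nat.exists_eq_succ_of_ne_zero hN0.ne'
  rw [Nat.succ_eq_add_one] at *
  obtain ⟨F, hF1, hF2⟩ := I.exists_testFun hα0 hε n.succ_pos hδ hδε
  have hF : IsTestFun I α ε δ (n + 1) F := ⟨hF1, hF2⟩
  refine ⟨F, hF, ?_⟩
  rw [rpow_mul_zrDirichlet]
  have hZ : 0 ≤ 1 / (partitionZ α m (n + 1) * maxMass m) :=
    one_div_nonneg.2 (mul_nonneg (partitionZ_nonneg hm _) hM.le)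
  refine mul_le_mul_of_nonneg_left ?_ hZ
  have hmain := hF.sum_weight_mul_walkDirichlet_le hr hm hM hα hε hδ hδε' hκ hS₁ hc hK.le hKε.le h2
  rw [← hδ'def, ← hL, ← hW] at hmain
  have hout := hE (n + 1) n n.succ_pos n.le_succ
  have hconv := convSum_le_mul hα0 n
  set N : ℝ := ((n + 1 : ℕ) : ℝ) with hNdef
  have hN : 0 < N := by positivity
  set T := N ^ (2 * α + 1) with hT
  have hT0 : 0 < T := Real.rpow_pos_of_pos hN _
  set B := IConst α * (1 - 2 * ε) ^ (2 * α + 1) with hB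
  have hB0 : 0 < B := mul_pos (IConst_pos hα0.le) (Real.rpow_pos_of_pos (by linarith) _)
  refine (mul_le_mul_of_nonneg_left hmain hT0.le).trans ?_
  rw [mul_add, add_assoc]
  refine add_le_add ?_ ?_
  · rw [Finset.mul_sum]
    refine Finset.sum_le_sum fun p _ => ?_
    have hX : 0 ≤ walkDirichlet r m (I.H p.1 p.2) *
        ∏ z ∈ Finset.univ \ {p.1, p.2}, partGamma α m K z :=
      mul_nonneg (walkDirichlet_nonneg hr hm _)
        (Finset.prod_nonneg fun z _ => zero_le_one.trans (one_le_partGamma hm K z))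
    rw [mul_left_comm]
    refine mul_le_mul_of_nonneg_left ?_ hX
    rw [mul_pow, mul_div_assoc', div_le_div_iff₀ (by positivity) (by positivity)]
    have := mul_le_mul_of_nonneg_left hconv (by positivity : 0 ≤ T * B ^ 2)
    linarith
  · have hδN : (δ' * N) ^ (2 * α) = δ' ^ (2 * α) * N ^ (2 * α) :=
      Real.mul_rpow hδ'.le hN.le
    have hTN : T = N ^ (2 * α) * N := by rw [hT, Real.rpow_add hN, Real.rpow_one]
    have hNs : N ^ (2 * α - 1 + (Fintype.card S : ℝ)) =
        N ^ (2 * α) / N * N ^ (Fintype.card S : ℝ) := by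
      rw [Real.rpow_add hN, Real.rpow_sub hN, Real.rpow_one]
    have hN2 := Real.rpow_pos_of_pos hN (2 * α)
    have hδ2 := Real.rpow_pos_of_pos hδ' (2 * α)
    rw [← Finset.mul_sum, hδN]
    have h5 : 0 ≤ T * ((L / N) ^ 2 * W) := mul_nonneg hT0.le (mul_nonneg (sq_nonneg _) hW0)
    have h6 := mul_le_mul_of_nonneg_left hout h5
    rw [← mul_assoc, mul_add]
    refine (add_le_add le_rfl h6).trans (le_of_eq ?_)
    rw [hNs, hTN]
    field_simp

theorem IsTestFun.eq_of_mem_wells {I : Interpolation (maxSites m)} {N : ℕ} {F : (S → ℕ) → ℝ}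
    (hF : IsTestFun I α ε δ N F) (hα : 0 < α) (hε : ε ≤ 1 / 4) (hN : 0 < N) (hδε : δ ≤ ε)
    (hκ : 2 ≤ (maxSites m).card) {ℓ : ℕ → ℝ} {b : ℕ → S → ℝ} (hℓ : ℓ N ≤ δ * N) {T : Finset S}
    (hT : T ⊆ maxSites m) {v : ℝ} (hv : ∀ x ∈ T, I.c x = v) {η : S → ℕ}
    (hη : η ∈ wells m ℓ b N T) : F η = v := by
  simp only [wells, Set.mem_iUnion] at hη
  obtain ⟨x, hx, hη, hηx, -⟩ := hη
  rw [hF.eq_of_near hα hε hN hδε hκ (hT hx) hη (by linarith), hv x hx]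

/-- The limit of the normalizing constants. -/
def limitZ (α : ℝ) (m : S → ℝ) : ℝ := ∑ x ∈ maxSites m, ∏ z ∈ Finset.univ \ {x}, siteGamma α m z

theorem limitZ_pos (hα : 1 < α) (hm : ∀ x, 0 ≤ m x) (hκ : 2 ≤ (maxSites m).card) :
    0 < limitZ α m :=
  Finset.sum_pos (fun _ _ => Finset.prod_pos fun z _ => siteGamma_pos hα hm z)
    (Finset.card_pos.1 (by omega))

theorem tendsto_inv_partitionZ_mul [Nonempty S] (hα : 1 < α) (hm : ∀ x, 0 ≤ m x)
    (hM : 0 < maxMass m) (hκ : 2 ≤ (maxSites m).card) :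
    Tendsto (fun N => 1 / (partitionZ α m N * maxMass m)) atTop
      (𝓝 (1 / (limitZ α m * maxMass m))) :=
  tendsto_const_nhds.div ((tendsto_partitionZ hα hm hM).mul_const _)
    (mul_pos (limitZ_pos hα hm hκ) hM).ne'

/-- `∑_{x ∈ S₁, y ∈ S⋆ \ S₁} Cap_S(x,y) ∏_{z ≠ x, y} ∑_j m⋆(z)^j / a(j)`. -/
def capSum (α : ℝ) (r : S → S → ℝ) (m : S → ℝ) (S₁ : Finset S) : ℝ :=
  ∑ p ∈ S₁ ×ˢ (maxSites m \ S₁),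
    walkCap r m p.1 p.2 * ∏ z ∈ Finset.univ \ {p.1, p.2}, siteGamma α m z

theorem tendsto_partCapSum (hα : 1 < α) (hm : ∀ x, 0 ≤ m x) (S₁ : Finset S) :
    Tendsto (partCapSum α r m S₁) atTop (𝓝 (capSum α r m S₁)) :=
  tendsto_finsetSum _ fun _ _ => (tendsto_prod_partGamma hα hm _).const_mul _

/-- Relative to the full product `P` over all sites, each term of `limitZ` lacks one factor `Γ(α)`
and each term of `capSum` lacks two, because the omitted sites lie in `S⋆`. -/
theorem limit_eq (hα : 1 < α) (hm : ∀ x, 0 ≤ m x) (hM : 0 < maxMass m)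
    (hκ : 2 ≤ (maxSites m).card) {S₁ : Finset S} (hS₁ : S₁ ⊆ maxSites m) :
    1 / (limitZ α m * maxMass m) * (capSum α r m S₁ / IConst α) =
      1 / (maxMass m * ((maxSites m).card : ℝ) * GammaConst α * IConst α) *
        ∑ x ∈ S₁, ∑ y ∈ maxSites m \ S₁, walkCap r m x y := by
  have hG := GammaConst_pos hα
  have hI := IConst_pos (zero_le_one.trans hα.le)
  have hκ' : 0 < ((maxSites m).card : ℝ) := by exact_mod_cast (by omega : 0 < (maxSites m).card)
  set P := ∏ z, siteGamma α m z with hP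
  have hP0 : 0 < P := Finset.prod_pos fun z _ => siteGamma_pos hα hm z
  have hZ : limitZ α m = (maxSites m).card * (P / GammaConst α) := by
    rw [limitZ, ← nsmul_eq_mul]
    refine Finset.sum_eq_card_nsmul fun x hx => ?_
    rw [eq_div_iff hG.ne', hP, ← Finset.prod_sdiff (Finset.subset_univ {x}), Finset.prod_singleton,
      siteGamma_of_mem hM hx]
  have hC : capSum α r m S₁ =
      (∑ x ∈ S₁, ∑ y ∈ maxSites m \ S₁, walkCap r m x y) * (P / GammaConst α ^ 2) := by
    rw [← Finset.sum_product', Finset.sum_mul, capSum]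
    refine Finset.sum_congr rfl fun p hp => ?_
    obtain ⟨h1, h2⟩ := Finset.mem_product.1 hp
    obtain ⟨h2, h3⟩ := Finset.mem_sdiff.1 h2
    have hne : p.1 ≠ p.2 := fun h => h3 (h ▸ h1)
    congr 1
    rw [eq_div_iff (by positivity), hP, ← Finset.prod_sdiff (Finset.subset_univ {p.1, p.2}),
      Finset.prod_pair hne, siteGamma_of_mem hM (hS₁ h1), siteGamma_of_mem hM h2, sq]
  rw [hZ, hC]
  field_simp

theorem bddBelow_zrDirichlet (hr : ∀ x y, 0 ≤ r x y) (hm : ∀ x, 0 ≤ m x) (N : ℕ)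
    (s : Set ((S → ℕ) → ℝ)) : BddBelow (zrDirichlet α r m N '' s) := by
  refine ⟨0, ?_⟩
  rintro _ ⟨F, -, rfl⟩
  exact zrDirichlet_nonneg hr hm N F

theorem eventually_le_mul {ℓ : ℕ → ℝ} (hℓN : Tendsto (fun N : ℕ => ℓ N / (N : ℝ)) atTop (𝓝 0))
    (hδ : 0 < δ) : ∀ᶠ N : ℕ in atTop, ℓ N ≤ δ * N := by
  filter_upwards [hℓN.eventually_lt_const hδ, eventually_gt_atTop 0] with N h hN
  exact ((div_lt_iff₀ (by exact_mod_cast hN)).1 h).le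

variable {ℓ : ℕ → ℝ} {b : ℕ → S → ℝ} {S₁ : Finset S}

theorem mem_admissible_of_isTestFun {I : Interpolation (maxSites m)} {N : ℕ} {F : (S → ℕ) → ℝ}
    (hF : IsTestFun I α ε δ N F) (hα : 0 < α) (hε : ε ≤ 1 / 4) (hN : 0 < N) (hδε : δ ≤ ε)
    (hκ : 2 ≤ (maxSites m).card) (hℓ : ℓ N ≤ δ * N) (hS₁ : S₁ ⊆ maxSites m)
    (hc : ∀ x, I.c x = if x ∈ S₁ then 1 else 0) :
    F ∈ {F : (S → ℕ) → ℝ | (∀ η ∈ wells m ℓ b N S₁, F η = 1) ∧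
      ∀ ξ ∈ wells m ℓ b N (maxSites m \ S₁), F ξ = 0} :=
  ⟨fun _ hη => hF.eq_of_mem_wells hα hε hN hδε hκ hℓ hS₁
      (fun x hx => by rw [hc, if_pos hx]) hη,
    fun _ hη => hF.eq_of_mem_wells hα hε hN hδε hκ hℓ Finset.sdiff_subset
      (fun x hx => by rw [hc, if_neg (Finset.mem_sdiff.1 hx).2]) hη⟩

theorem eventually_zrCap_lt [Nonempty S] (hr : ∀ x y, 0 ≤ r x y) (hm : ∀ x, 0 ≤ m x)
    (hM : 0 < maxMass m) (hα : 1 < α) (hκ : 2 ≤ (maxSites m).card) (hS₁ : S₁ ⊆ maxSites m)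
    (hℓN : Tendsto (fun N : ℕ => ℓ N / (N : ℝ)) atTop (𝓝 0)) {c : ℝ}
    (hcL : 1 / (limitZ α m * maxMass m) * (capSum α r m S₁ / IConst α) < c) :
    ∀ᶠ N : ℕ in atTop, (N : ℝ) ^ (1 + α) *
      zrCap α r m N (wells m ℓ b N S₁) (wells m ℓ b N (maxSites m \ S₁)) < c := by
  have hα0 : 0 < α := by linarith
  have hI := IConst_pos hα0.le
  have hZM : 0 < limitZ α m * maxMass m := mul_pos (limitZ_pos hα hm hκ) hM
  let Γp : S × S → ℝ := fun p => ∏ z ∈ Finset.univ \ {p.1, p.2}, siteGamma α m z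
  have hΓp : ∀ p, 0 ≤ Γp p := fun p => Finset.prod_nonneg fun z _ => (siteGamma_pos hα hm z).le
  -- The single parameter `t` serves both as the slack in the walk capacities and as the margin `ε`
  -- of the profile. Continuity of `u` at `0` allows a choice of `t` with `u t < c`.
  let u : ℝ → ℝ := fun t => 1 / (limitZ α m * maxMass m) *
    ∑ p ∈ S₁ ×ˢ (maxSites m \ S₁), (walkCap r m p.1 p.2 + t) * Γp p *
      (IConst α / (IConst α * (1 - 2 * t) ^ (2 * α + 1)) ^ 2)
  have hu0 : u 0 = 1 / (limitZ α m * maxMass m) * (capSum α r m S₁ / IConst α) := by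
    simp only [u, capSum, Finset.sum_div, Γp]
    congr 1
    refine Finset.sum_congr rfl fun p _ => ?_
    simp only [mul_zero, sub_zero, Real.one_rpow, mul_one, add_zero]
    field_simp
  have hucont : ContinuousAt u 0 := by
    have h1 : ContinuousAt (fun t : ℝ => (1 - 2 * t) ^ (2 * α + 1)) 0 :=
      ContinuousAt.rpow_const (by fun_prop) (Or.inr (by linarith))
    refine continuousAt_const.mul (tendsto_finsetSum _ fun p _ => ?_)
    refine ContinuousAt.mul (by fun_prop) (continuousAt_const.div
      ((continuousAt_const.mul h1).pow 2) ?_)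
    simp [hI.ne']
  obtain ⟨t, htc, ht0, ht4⟩ : ∃ t, u t < c ∧ 0 < t ∧ t ≤ 1 / 4 := by
    have h1 : ∀ᶠ t in 𝓝[>] (0 : ℝ), u t < c :=
      (hucont.tendsto.mono_left nhdsWithin_le_nhds).eventually_lt_const (hu0 ▸ hcL)
    have h2 : ∀ᶠ t in 𝓝[>] (0 : ℝ), t ∈ Set.Ioc (0 : ℝ) (1 / 4) :=
      Ioc_mem_nhdsGT (by norm_num)
    obtain ⟨t, h, h'⟩ := (h1.and h2).exists
    exact ⟨t, h, h'.1, h'.2⟩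
  obtain ⟨I, hc, hIH⟩ := exists_interpolation hr hm (maxSites m) S₁ ht0
  have hd : (0 : ℝ) < Fintype.card S + 2 := by positivity
  set δ := t / (Fintype.card S + 2) with hδdef
  have hδ : 0 < δ := div_pos ht0 hd
  have hδt : (Fintype.card S + 2) * δ ≤ t := (mul_div_cancel₀ t hd.ne').le
  have hδt' : δ ≤ t := div_le_self ht0.le (by linarith [(Nat.cast_nonneg _ : (0 : ℝ) ≤ Fintype.card S)])
  obtain ⟨C₁, C₂, s, q, hq, hF⟩ := exists_isTestFun_le hr hm hM hα ht4 hδ hδt hκ hS₁ I hc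
  have hlt : 1 / (limitZ α m * maxMass m) *
      (∑ p ∈ S₁ ×ˢ (maxSites m \ S₁), walkDirichlet r m (I.H p.1 p.2) * Γp p *
          (IConst α / (IConst α * (1 - 2 * t) ^ (2 * α + 1)) ^ 2) +
        C₁ * ∑ _p ∈ (maxSites m).offDiag, (0 : ℝ) + 0) < c := by
    refine lt_of_le_of_lt ?_ htc
    simp only [Finset.sum_const_zero, mul_zero, add_zero, u]
    refine mul_le_mul_of_nonneg_left (Finset.sum_le_sum fun p hp => ?_) (by positivity)
    obtain ⟨h1, h2⟩ := Finset.mem_product.1 hp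
    have h3 := hIH p.1 h1 p.2 (Finset.mem_sdiff.1 h2).2
    have h4 := hΓp p
    gcongr
  refine le_of_eventually_le_family (fun K => ?_) (fun K =>
    (tendsto_inv_partitionZ_mul hα hm hM hκ).mul (((tendsto_finsetSum _ fun p _ =>
      (((tendsto_convSum_bound hα0).div_const _).const_mul _)).add_const _).add
        (tendsto_rpow_mul_exp_neg C₂ s q hq)))
    ((((tendsto_finsetSum _ fun p _ =>
      (((tendsto_prod_partGamma hα hm _).const_mul _).mul_const _)).add
        ((tendsto_finsetSum _ fun p _ => tendsto_boxTail hα hm {p.1, p.2}).const_mul C₁)).add_const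
          0).const_mul _) hlt
  filter_upwards [hF K, eventually_le_mul hℓN hδ, eventually_gt_atTop 0] with N hFN hℓN hN
  obtain ⟨F, hFt, hle⟩ := hFN
  refine le_trans (mul_le_mul_of_nonneg_left ?_ (by positivity)) hle
  exact csInf_le (bddBelow_zrDirichlet hr hm N _)
    ⟨F, mem_admissible_of_isTestFun hFt hα0 ht4 hN hδt' hκ hℓN hS₁ hc, rfl⟩

theorem eventually_lt_zrCap [Nonempty S] (hr : ∀ x y, 0 ≤ r x y) (hm : ∀ x, 0 ≤ m x)
    (hM : 0 < maxMass m) (hα : 1 < α) (hκ : 2 ≤ (maxSites m).card) (hS₁ : S₁ ⊆ maxSites m)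
    (hℓ : Tendsto ℓ atTop atTop)
    (hℓN : Tendsto (fun N : ℕ => ℓ N / (N : ℝ)) atTop (𝓝 0))
    (hb : ∀ z, z ∉ maxSites m → Tendsto (fun N => b N z) atTop atTop) {c : ℝ}
    (hcL : c < 1 / (limitZ α m * maxMass m) * (capSum α r m S₁ / IConst α)) :
    ∀ᶠ N : ℕ in atTop, c < (N : ℝ) ^ (1 + α) *
      zrCap α r m N (wells m ℓ b N S₁) (wells m ℓ b N (maxSites m \ S₁)) := by
  have hα0 : 0 < α := by linarith
  have hI := IConst_pos hα0.le
  refine ge_of_eventually_ge_family (fun K => ?_) (fun K =>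
    (tendsto_inv_partitionZ_mul hα hm hM hκ).mul
      ((tendsto_const_nhds (x := partCapSum α r m S₁ K)).div (tendsto_convSum_bound hα0) hI.ne'))
    (((tendsto_partCapSum hα hm S₁).div_const _).const_mul _) hcL
  -- The interpolation serves only to show that admissible functions exist, so that the infimum is
  -- not over the empty set. Any slack will do.
  obtain ⟨I, hc, -⟩ := exists_interpolation hr hm (maxSites m) S₁ one_pos
  have hd : (0 : ℝ) < Fintype.card S + 2 := by positivity
  set δ : ℝ := 1 / 4 / (Fintype.card S + 2) with hδdef
  have hδ : 0 < δ := by positivity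
  have hδε : (Fintype.card S + 2) * δ ≤ 1 / 4 := (mul_div_cancel₀ (1 / 4) hd.ne').le
  have hδε' : δ ≤ 1 / 4 :=
    div_le_self (by norm_num) (by linarith [(Nat.cast_nonneg _ : (0 : ℝ) ≤ Fintype.card S)])
  have hbK : ∀ᶠ N in atTop, ∀ z ∉ maxSites m, (K : ℝ) ≤ b N z := by
    refine eventually_all.2 fun z => ?_
    by_cases hz : z ∈ maxSites m
    · exact Eventually.of_forall fun N h => absurd hz h
    · filter_upwards [(hb z hz).eventually_ge_atTop (K : ℝ)] with N h _
      exact h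
  -- For fixed `K`, `ℓ_N ≥ |S| K + K + 1` and `b_N ≥ K` eventually place the ends of all segments
  -- inside the wells.
  filter_upwards [eventually_le_mul hℓN hδ, hbK,
    hℓ.eventually_ge_atTop ((Fintype.card S * K + K + 1 : ℕ) : ℝ),
    eventually_gt_atTop (Fintype.card S * K + (2 * K + 1))] with N hℓN' hbN hℓN hN
  obtain ⟨n, rfl⟩ := Nat.exists_eq_succ_of_ne_zero (by omega : N ≠ 0)
  rw [Nat.succ_eq_add_one] at *
  obtain ⟨F₀, hF₁, hF₂⟩ := I.exists_testFun hα0 le_rfl n.succ_pos hδ hδε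
  have hne := mem_admissible_of_isTestFun (b := b) (⟨hF₁, hF₂⟩ : IsTestFun I α (1 / 4) δ (n + 1) F₀)
    hα0 le_rfl n.succ_pos hδε' hκ hℓN' hS₁ hc
  have hpos : 0 < ((n + 1 : ℕ) : ℝ) ^ (1 + α) := by positivity
  rw [← div_le_iff₀' hpos]
  refine le_csInf ⟨_, F₀, hne, rfl⟩ ?_
  rintro _ ⟨F, ⟨h1, h0⟩, rfl⟩
  rw [div_le_iff₀' hpos, rpow_mul_zrDirichlet]
  have hZ : 0 ≤ 1 / (partitionZ α m (n + 1) * maxMass m) :=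
    one_div_nonneg.2 (mul_nonneg (partitionZ_nonneg hm _) hM.le)
  refine mul_le_mul_of_nonneg_left ?_ hZ
  have hwell : ∀ x, ∀ η ∈ configs S (n + 1), n + 1 ≤ η x + (Fintype.card S * K + K + 1) →
      (∀ z ∉ maxSites m, η z ≤ K) → η ∈ well m ℓ b (n + 1) x := by
    intro x η hη hx hz
    refine ⟨hη, ?_, fun z hz' => ?_⟩
    · have h2 : ((n + 1 : ℕ) : ℝ) ≤ η x + ((Fintype.card S * K + K + 1 : ℕ) : ℝ) := by
        exact_mod_cast hx
      linarith
    · exact le_trans (by exact_mod_cast hz z hz') (hbN z hz')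
  have hle := partCapSum_le (F := F) hα0.le hr hm hM hS₁ (by omega : _ ≤ n)
    (fun x hx η hη h2 h3 => h1 η (Set.mem_biUnion hx (hwell x η hη h2 h3)))
    (fun x hx η hη h2 h3 => h0 η (Set.mem_biUnion hx (hwell x η hη h2 h3)))
  have hsum : 0 ≤ ∑ ξ ∈ configs S n, weight α m ξ * walkDirichlet r m fun z => F (addOne ξ z) :=
    Finset.sum_nonneg fun ξ _ => mul_nonneg (weight_nonneg hm ξ) (walkDirichlet_nonneg hr hm _)
  rw [Pi.div_apply, div_le_iff₀ (by positivity)]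
  refine hle.trans ((mul_le_mul_of_nonneg_right (convSum_le_mul hα0 n) hsum).trans (le_of_eq ?_))
  ring

end limits

end ZeroRange

end

/-! ### Asymptotics of the capacity between wells -/

theorem theorem2p2 {S : Type*} [Fintype S] [DecidableEq S]
    (α : ℝ) (hα : 1 < α)
    (r : S → S → ℝ) (hr : ∀ x y, 0 ≤ r x y) (hirr : ZeroRange.Irreducible r)
    (m : S → ℝ) (hm : ∀ x, 0 ≤ m x) (hm1 : ∑ x, m x = 1)
    (hrev : ∀ x y, m x * r x y = m y * r y x)
    (hκ : 2 ≤ (ZeroRange.maxSites m).card)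
    (ℓ : ℕ → ℝ) (hℓ : Tendsto ℓ atTop atTop)
    (hℓN : Tendsto (fun N : ℕ => ℓ N / (N : ℝ)) atTop (𝓝 0))
    (b : ℕ → S → ℝ)
    (hb : ∀ z, z ∉ ZeroRange.maxSites m → Tendsto (fun N => b N z) atTop atTop)
    (S₁ : Finset S) (hS₁ : S₁.Nonempty) (hS₁' : S₁ ⊂ ZeroRange.maxSites m) :
    Tendsto
      (fun N : ℕ => (N : ℝ) ^ (1 + α) *
        ZeroRange.zrCap α r m N (ZeroRange.wells m ℓ b N S₁)
          (ZeroRange.wells m ℓ b N (ZeroRange.maxSites m \ S₁)))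
      atTop
      (𝓝 (1 / (ZeroRange.maxMass m * ((ZeroRange.maxSites m).card : ℝ) *
            ZeroRange.GammaConst α * ZeroRange.IConst α) *
          ∑ x ∈ S₁, ∑ y ∈ ZeroRange.maxSites m \ S₁, ZeroRange.walkCap r m x y)) := by

  have hM : 0 < ZeroRange.maxMass m := by
    by_contra h
    have h0 : ∑ x, m x ≤ 0 :=
      Finset.sum_nonpos fun x _ => (ZeroRange.le_maxMass x).trans (not_lt.1 h)
    linarith
  obtain ⟨x₀, -⟩ := hS₁
  have : Nonempty S := ⟨x₀⟩
  rw [← ZeroRange.limit_eq hα hm hM hκ hS₁'.1]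
  exact tendsto_order.2
    ⟨fun c hc => ZeroRange.eventually_lt_zrCap hr hm hM hα hκ hS₁'.1 hℓ hℓN hb hc,
      fun c hc => ZeroRange.eventually_zrCap_lt hr hm hM hα hκ hS₁'.1 hℓN hc⟩
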